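/- **Setting.** Let $X$ (features), $Y$ (label, in a countable set $\mathcal Y$), $T$ (sensitive attribute) be random variables. Let $\beta(x,\hat y)=\Pr(\widehat Y^\beta=\hat y\mid X=x)$ be a stochastic classifier (the behavior model), with prediction $\widehat Y^\beta$ and real-valued delayed impact $I^\beta$. For each $\theta\in\Theta$ let $\pi_\theta(x,\hat y)=\Pr(\widehat Y^{\pi_\theta}=\hat y\mid X=x)$ be a stochastic classifier with prediction $\widehat Y^{\pi_\theta}$ and real-valued delayed impact $I^{\pi_\theta}$. Let $D=\{(X_i,Y_i,T_i,\widehat Y_i^\beta,I_i^\beta)\}_{i=1}^n$ be i.i.d. copies of $(X,Y,T,\widehat Y^\beta,I^\beta)$. For $j\in\{1,\dots,k\}$ let $c_j$ be a Boolean function of $(x,y,t)$, $\tau_j\in\mathbb R$, $\delta_j\in(0,1)$, and define the delayed-impact objective $$g_j(\theta)=\tau_j-\mathbf E\bigl[I^{\pi_\theta}\mid c_j(X,Y,T)\bigr],\qquad g_j(\mathtt{NSF})=0 .$$ **Algorithm $a$ (ELF with multiple constraints).** The index set of $D$ is partitioned (independently of the data) so that $D$ splits into $D_c$ and $D_f$.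 Candidate selection computes $\theta_c\in\Theta$ as a measurable function of $D_c$ alone (for instance, a minimizer of a cost computed from $D_c$; the result holds for every such rule). For each $j$, let $\hat g_j$ be the vector of the estimates $$\tau_j-\frac{\pi_{\theta_c}(X_i,\widehat Y_i^\beta)}{\beta(X_i,\widehat Y_i^\beta)}\,I_i^\beta$$ over the points of $D_f$ for which $c_j(X_i,Y_i,T_i)$ is true, let $m$ be its length, $\bar z$ its average and $\sigma$ its sample standard deviation (with Bessel's correction). Let $$U_j=\bar z+(b_j-a_j)\sqrt{\frac{\ln(1/\delta_j)}{2m}}\quad(\text{Hoeffding bound}),\qquad U_j=\bar z+\frac{\sigma}{\sqrt m}\,t_{1-\delta_j,\,m-1}\quad(t\text{-test bound}),$$ where $t_{p,\nu}$ is the $p$-quantile of Student's $t$ distribution with $\nu$ degrees of freedom, and $U_j=+\infty$ if the formula is undefined ($m=0$, respectively $m\le 1$). One of the two bounds is chosen beforehand and used for all $j$. The output $a(D)$ is $\theta_c$ if $U_j\le 0$ for all $j$, and $\mathtt{NSF}$ ("no solution found") otherwise. **Assumptions.** 1. (Markov property) $\Pr(\widehat Y=\hat y\mid X,Y,T)=\Pr(\widehat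 Y=\hat y\mid X)$ for every $\hat y$, both for $\widehat Y=\widehat Y^\beta$ and for $\widehat Y=\widehat Y^{\pi_\theta}$, $\theta\in\Theta$. 2. (Impact invariance) For every $\theta\in\Theta$, the conditional distribution of $I^\beta$ given $X=x,Y=y,T=t,\widehat Y^\beta=\hat y$ equals that of $I^{\pi_\theta}$ given $X=x,Y=y,T=t,\widehat Y^{\pi_\theta}=\hat y$. 3. (Support) For all $\theta\in\Theta$, $x$ and $\hat y$: $\pi_\theta(x,\hat y)>0$ implies $\beta(x,\hat y)>0$. 4. If the Hoeffding bound is used, then for every $j$, almost surely each estimate in $\hat g_j$ lies in $[a_j,b_j]$. If the $t$-test bound is used, then for every $j$ the average of $\hat g_j$ is normally distributed (possibly with variance $0$) conditionally on $D_c$ and on the number $m\ge 1$ of estimates in $\hat g_j$. **Theorem 2.** Under these assumptions, for every $j\in\{1,\dots,k\}$, $$\Pr\bigl(g_j(a(D))\le 0\bigr)\ \ge\ 1-\delta_j .$$ In other words, for each constraint the algorithm returns a model that is unfair with respect to that delayed-impact constraint with probability at most $\delta_j$. -/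

import Mathlib

open MeasureTheory ProbabilityTheory

noncomputable section

namespace ELF

/-! ### Sample statistics, Student's `t` quantile, and the two upper confidence bounds -/

section Bounds

variable {ι : Type*}

/-- The average of the sample `(z i)_{i ∈ s}`. -/
def sampleMean (s : Finset ι) (z : ι → ℝ) : ℝ :=
  (∑ i ∈ s, z i) / (s.card : ℝ)

/-- The sample standard deviation, with Bessel's correction, of the sample `(z i)_{i ∈ s}`. -/
def sampleStd (s : Finset ι) (z : ι → ℝ) : ℝ :=
  Real.sqrt ((∑ i ∈ s, (z i - sampleMean s z) ^ 2) / ((s.card : ℝ) - 1))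

/-- The chi-squared distribution with `ν` degrees of freedom: the law of the sum of the squares
of `ν` independent standard normal variables. -/
def chiSquared (ν : ℕ) : Measure ℝ :=
  (Measure.pi fun _ : Fin ν => gaussianReal 0 1).map fun w => ∑ i, w i ^ 2

/-- Student's `t` distribution with `ν` degrees of freedom: the law of `Z / √(V / ν)`, where `Z` is
standard normal, `V` is chi-squared with `ν` degrees of freedom, and `Z`, `V` are independent. -/
def studentT (ν : ℕ) : Measure ℝ :=
  ((gaussianReal 0 1).prod (chiSquared ν)).map fun p => p.1 / Real.sqrt (p.2 / (ν : ℝ))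

/-- The `p`-quantile of Student's `t` distribution with `ν` degrees of freedom. -/
def tQuantile (p : ℝ) (ν : ℕ) : ℝ :=
  sInf {x : ℝ | p ≤ (studentT ν).real (Set.Iic x)}

/-- The Hoeffding upper bound for a sample of size `m` with values in `[a, b]`:
`z̄ + (b - a) √(ln (1/δ) / (2m))`. The empty sample gives no information: the bound is `+∞`. -/
def boundHoeff (a b δ : ℝ) (s : Finset ι) (z : ι → ℝ) : EReal :=
  if s.card = 0 then ⊤
  else ((sampleMean s z
    + (b - a) * Real.sqrt (Real.log (1 / δ) / (2 * (s.card : ℝ))) : ℝ) : EReal)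

/-- The Student `t`-test upper bound for a sample of size `m ≥ 2`:
`z̄ + (σ / √m) t_{1 - δ, m - 1}`. For `m ≤ 1` the sample standard deviation (or already the mean)
is undefined, and the bound is `+∞`. -/
def boundTtest (δ : ℝ) (s : Finset ι) (z : ι → ℝ) : EReal :=
  if s.card ≤ 1 then ⊤
  else ((sampleMean s z
    + sampleStd s z / Real.sqrt (s.card : ℝ) * tQuantile (1 - δ) (s.card - 1) : ℝ) : EReal)

end Bounds

/-- The choice of the confidence bound. -/
inductive Bound
  | hoeff
  | ttest

/-! ### Data points and the algorithm -/

/-- A data point `(x, y, t, ŷ, i)`: features, label, sensitive attribute, prediction of the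
behavior model, and delayed impact. -/
abbrev DataPoint (𝓧 𝓨 𝓣 : Type*) := 𝓧 × 𝓨 × 𝓣 × 𝓨 × ℝ

/-- The part `(x, y, t)` of a data point `(x, y, t, ŷ, i)`. -/
def DataPoint.xyt {𝓧 𝓨 𝓣 : Type*} (p : DataPoint 𝓧 𝓨 𝓣) : 𝓧 × 𝓨 × 𝓣 :=
  (p.1, p.2.1, p.2.2.1)

/-- The inputs and the ingredients of ELF with `k` constraints on a dataset of size `n`. -/
structure Input (𝓧 𝓨 𝓣 Θ : Type*) [MeasurableSpace 𝓧] [MeasurableSpace 𝓨] [MeasurableSpace 𝓣]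
    [MeasurableSpace Θ] (n k : ℕ) where
  /-- the Boolean conditionals `c_j` -/
  c : Fin k → 𝓧 × 𝓨 × 𝓣 → Bool
  /-- the confidence levels `δ_j` -/
  δ : Fin k → ℝ
  /-- the tolerances `τ_j` -/
  τ : Fin k → ℝ
  /-- the lower end points `a_j` of the intervals in the Hoeffding bounds -/
  a : Fin k → ℝ
  /-- the upper end points `b_j` of the intervals in the Hoeffding bounds -/
  b : Fin k → ℝ
  /-- the behavior model: `β x` is a distribution on the labels -/
  β : Kernel 𝓧 𝓨
  /-- the parametrized models: `pol (θ, x)` is a distribution on the labels -/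
  pol : Kernel (Θ × 𝓧) 𝓨
  /-- which of the two bounds is used -/
  bound : Bound
  /-- the partition of the dataset: the indices of the points of `D_f`; the others form `D_c` -/
  fair : Finset (Fin n)
  /-- candidate selection: the candidate solution `θ_c` as a function of `D_c` alone. Nothing else
  is asked of it later but measurability, so that minimizing a cost computed from `D_c` is a
  special case. -/
  select : ({i : Fin n // i ∉ fair} → DataPoint 𝓧 𝓨 𝓣) → Θ

namespace Input

variable {𝓧 𝓨 𝓣 Θ : Type*} [MeasurableSpace 𝓧] [MeasurableSpace 𝓨] [MeasurableSpace 𝓣]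
  [MeasurableSpace Θ] {n k : ℕ} (E : Input 𝓧 𝓨 𝓣 Θ n k)

/-- `β(x, ŷ)`. -/
def behavProb (x : 𝓧) (y : 𝓨) : ℝ := (E.β x).real {y}

/-- `π_θ(x, ŷ)`. -/
def polProb (θ : Θ) (x : 𝓧) (y : 𝓨) : ℝ := (E.pol (θ, x)).real {y}

/-- The candidate solution `θ_c`. -/
def candidate (D : Fin n → DataPoint 𝓧 𝓨 𝓣) : Θ := E.select fun i => D i.1

/-- The importance sampling estimate `τ_j - (π_θ(x, ŷ) / β(x, ŷ)) i` of `g_j(θ)` from a data point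
`(x, y, t, ŷ, i)`. -/
def estimate (j : Fin k) (θ : Θ) (p : DataPoint 𝓧 𝓨 𝓣) : ℝ :=
  E.τ j - E.polProb θ p.1 p.2.2.2.1 / E.behavProb p.1 p.2.2.2.1 * p.2.2.2.2

/-- The indices of the points of `D_f` at which `c_j` is true. The vector `ĝ_j` of the algorithm
consists of the estimates at these points. -/
def fairIdx (j : Fin k) (D : Fin n → DataPoint 𝓧 𝓨 𝓣) : Finset (Fin n) :=
  E.fair.filter fun i => E.c j (D i).xyt = true

/-- The average `Avg(ĝ_j)` of the estimates computed with the model `θ`. -/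
def avgEstimate (j : Fin k) (θ : Θ) (D : Fin n → DataPoint 𝓧 𝓨 𝓣) : ℝ :=
  sampleMean (E.fairIdx j D) fun i => E.estimate j θ (D i)

/-- The upper bound `U_j` on `g_j(θ_c)`. -/
def upper (j : Fin k) (D : Fin n → DataPoint 𝓧 𝓨 𝓣) : EReal :=
  match E.bound with
  | .hoeff => boundHoeff (E.a j) (E.b j) (E.δ j) (E.fairIdx j D)
      fun i => E.estimate j (E.candidate D) (D i)
  | .ttest => boundTtest (E.δ j) (E.fairIdx j D)
      fun i => E.estimate j (E.candidate D) (D i)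

open Classical in
/-- The output `a(D)` of the algorithm: the candidate solution if all the upper bounds are at most
`0`, and otherwise `none`, which stands for `NSF` (no solution found). -/
def run (D : Fin n → DataPoint 𝓧 𝓨 𝓣) : Option Θ :=
  if ∀ j, E.upper j D ≤ 0 then some (E.candidate D) else none

end Input

/-! ### The delayed-impact objectives and the assumptions -/

section Population

variable {Ω₀ 𝓧 𝓨 𝓣 Θ : Type*} [MeasurableSpace Ω₀] [MeasurableSpace 𝓧] [MeasurableSpace 𝓨]
  [MeasurableSpace 𝓣] [MeasurableSpace Θ]

/-- The delayed-impact objective `g(θ) = τ - E[I^{π_θ} | c(X, Y, T)]`, with `g(NSF) = 0`. -/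
def objective (μ : Measure Ω₀) (X : Ω₀ → 𝓧) (Y : Ω₀ → 𝓨) (T : Ω₀ → 𝓣) (I : Θ → Ω₀ → ℝ)
    (c : 𝓧 × 𝓨 × 𝓣 → Bool) (τ : ℝ) : Option Θ → ℝ
  | none => 0
  | some θ => τ - ∫ ω, I θ ω ∂(cond μ {ω | c (X ω, Y ω, T ω) = true})

/-- A prediction `Yhat` is conditionally independent of `Y` and `T` given `X`:
`Pr(Yhat = ŷ | X, Y, T) = Pr(Yhat = ŷ | X)` for all `ŷ`. -/
def MarkovProperty (μ : Measure Ω₀) (X : Ω₀ → 𝓧) (Y : Ω₀ → 𝓨) (T : Ω₀ → 𝓣) (Yhat : Ω₀ → 𝓨) :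
    Prop :=
  ∀ y : 𝓨,
    μ⟦Yhat ⁻¹' {y} | MeasurableSpace.comap (fun ω => (X ω, Y ω, T ω)) inferInstance⟧
      =ᵐ[μ] μ⟦Yhat ⁻¹' {y} | MeasurableSpace.comap X inferInstance⟧

/-- The impact `I₁` given `X, Y, T` and the prediction `Y₁` has the same conditional distribution
as the impact `I₂` given `X, Y, T` and the prediction `Y₂`: one and the same kernel
`(x, y, t, ŷ) ↦ κ (x, y, t, ŷ)` is a version of both. -/
def ImpactInvariance (μ : Measure Ω₀) (X : Ω₀ → 𝓧) (Y : Ω₀ → 𝓨) (T : Ω₀ → 𝓣)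
    (Y₁ : Ω₀ → 𝓨) (I₁ : Ω₀ → ℝ) (Y₂ : Ω₀ → 𝓨) (I₂ : Ω₀ → ℝ) : Prop :=
  ∃ κ : Kernel (𝓧 × 𝓨 × 𝓣 × 𝓨) ℝ, IsMarkovKernel κ ∧
    HasCondDistrib I₁ (fun ω => (X ω, Y ω, T ω, Y₁ ω)) κ μ ∧
    HasCondDistrib I₂ (fun ω => (X ω, Y ω, T ω, Y₂ ω)) κ μ

end Population

section Estimates

variable {Ω 𝓧 𝓨 𝓣 Θ : Type*} [MeasurableSpace Ω] [MeasurableSpace 𝓧] [MeasurableSpace 𝓨]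
  [MeasurableSpace 𝓣] [MeasurableSpace Θ] {n k : ℕ}

/-- Every model of the feasible set is supported by the behavior model. -/
def Support (E : Input 𝓧 𝓨 𝓣 Θ n k) : Prop :=
  ∀ (θ : Θ) (x : 𝓧) (y : 𝓨), 0 < E.polProb θ x y → 0 < E.behavProb x y

/-- Almost surely, all the estimates in `ĝ_j` lie in `[a_j, b_j]`. -/
def EstimatesBounded (E : Input 𝓧 𝓨 𝓣 Θ n k) (P : Measure Ω)
    (D : Ω → Fin n → DataPoint 𝓧 𝓨 𝓣) : Prop :=
  ∀ j : Fin k, ∀ᵐ ω ∂P, ∀ i ∈ E.fairIdx j (D ω),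
    E.estimate j (E.candidate (D ω)) (D ω i) ∈ Set.Icc (E.a j) (E.b j)

/-- Each `Avg(ĝ_j)` is normally distributed, conditionally on the candidate data and on the number
`m ≥ 1` of estimates in `ĝ_j`: for almost every value of the candidate solution `θ_c` (that of the
outcome `ω`), which the conditioning freezes, the average over the fairness data (that of the
outcome `ω'`, independent of the candidate data) of the estimates with this `θ_c` is normal given
that there are `m` of them, for every `m ≥ 1` for which this event has positive probability.
A constant counts as normal with variance `0`. -/
def AveragesNormal (E : Input 𝓧 𝓨 𝓣 Θ n k) (P : Measure Ω)
    (D : Ω → Fin n → DataPoint 𝓧 𝓨 𝓣) : Prop :=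
  ∀ j : Fin k, ∀ᵐ ω ∂P, ∀ m : ℕ, 1 ≤ m →
    P {ω' | (E.fairIdx j (D ω')).card = m} ≠ 0 →
    IsGaussian ((cond P {ω' | (E.fairIdx j (D ω')).card = m}).map
      fun ω' => E.avgEstimate j (E.candidate (D ω)) (D ω'))

/-- The requirements of the chosen confidence bound. -/
def EstimatesMatchBound (E : Input 𝓧 𝓨 𝓣 Θ n k) (P : Measure Ω)
    (D : Ω → Fin n → DataPoint 𝓧 𝓨 𝓣) : Prop :=
  (E.bound = Bound.hoeff → EstimatesBounded E P D) ∧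
  (E.bound = Bound.ttest → AveragesNormal E P D)

end Estimates

end ELF

end

noncomputable section

namespace ELF

/-! ### Student's `t` statistic of a Gaussian sample -/

/-! Since `NSF` has objective `0`, constraint `j` can fail only if `U_j ≤ 0` while the candidate is
unfair. Each constraint is treated alone, so no union bound enters.

The candidate is a function of `D_c`, which is independent of `D_f`. Fubini
(`measure_indepFun_eq_lintegral`) therefore freezes it: it suffices to bound the probability of `U_j
≤ 0` by `δ_j` for a fixed `θ` with `g_j(θ) > 0`. The sample size is still random. Conditioning on
the exact set `A` of indices in `D_f` where `c_j` holds removes this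
(`measure_le_of_cond_fiber_le`): given `A`, the estimates are i.i.d. with the law of one estimate
given `c_j` (`iIndepFun_cond_trueIdx`, `map_cond_trueIdx`). Importance sampling identifies the mean
of that law with `g_j(θ)` (`integral_cond_importanceSampling`). What remains is the validity of a
classical confidence bound, as `U_j ≤ 0 < g_j(θ)` puts the bound strictly below the mean.

For Hoeffding's bound this is the sub-Gaussian tail estimate (`measureReal_hoeffding_lt`). For the
`t`-test only the average is assumed normal, given the sample size `m`. The characteristic function
of one estimate is then a continuous `m`-th root of a Gaussian one, which forces each estimate to be
normal (`exists_eq_gaussianReal_of_isGaussian_mean`). Student's theorem then applies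
(`measureReal_ttest_lt`): a rotation taking the constant vector to a basis vector separates the mean
from the deviations. -/

instance isProbabilityMeasure_chiSquared (ν : ℕ) : IsProbabilityMeasure (chiSquared ν) :=
  Measure.isProbabilityMeasure_map (Measurable.aemeasurable (by fun_prop))

instance isProbabilityMeasure_studentT (ν : ℕ) : IsProbabilityMeasure (studentT ν) :=
  Measure.isProbabilityMeasure_map (Measurable.aemeasurable (by fun_prop))

/-- The sum of squared deviations from the mean. -/
theorem sum_sub_sampleMean_sq {ι : Type*} (s : Finset ι) (z : ι → ℝ) (hs : s.Nonempty) :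
    ∑ i ∈ s, (z i - sampleMean s z) ^ 2
      = ∑ i ∈ s, z i ^ 2 - (s.card : ℝ) * sampleMean s z ^ 2 := by
  have hm : (s.card : ℝ) ≠ 0 := by exact_mod_cast hs.card_pos.ne'
  have h : ∑ i ∈ s, z i = (s.card : ℝ) * sampleMean s z := by
    rw [sampleMean]; field_simp
  simp only [sub_sq, Finset.sum_add_distrib, Finset.sum_sub_distrib, ← Finset.sum_mul,
    ← Finset.mul_sum, Finset.sum_const, nsmul_eq_mul, h]
  ring

/-- The normalized constant vector is the direction whose coordinate is `√m` times the sample mean;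
any orthonormal completion serves. -/
theorem exists_orthonormalBasis_const (ι : Type*) [Fintype ι] {ν : ℕ}
    (hν : Fintype.card ι = ν + 1) :
    ∃ b : OrthonormalBasis (Fin (ν + 1)) ℝ (EuclideanSpace ℝ ι),
      b 0 = WithLp.toLp 2 fun _ => (Real.sqrt (Fintype.card ι : ℝ))⁻¹ := by
  classical
  have hpos : (0 : ℝ) < Fintype.card ι := by rw [hν]; positivity
  have := Orthonormal.exists_orthonormalBasis_extension_of_card_eq (𝕜 := ℝ)
    (E := EuclideanSpace ℝ ι) (ι := Fin (ν + 1)) (by simp [hν])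
    (v := fun _ => WithLp.toLp 2 fun _ => (Real.sqrt (Fintype.card ι : ℝ))⁻¹)
    (s := {0}) ?_
  · obtain ⟨b, hb⟩ := this
    exact ⟨b, hb 0 rfl⟩
  · constructor
    · intro i
      simp only [Set.domRestrict_apply, EuclideanSpace.norm_eq]
      rw [Real.sqrt_eq_one]
      simp only [Real.norm_eq_abs, sq_abs, inv_pow, Real.sq_sqrt hpos.le, Finset.sum_const,
        Finset.card_univ, nsmul_eq_mul]
      field_simp
    · intro i j hij
      exact absurd (Subsingleton.elim i j) hij

/-- The scaled mean and the sum of squared deviations of a standard normal sample are independent,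
standard normal and chi-squared. -/
theorem map_sampleMean_sumSq {ι : Type*} [Fintype ι] {ν : ℕ} (hν : Fintype.card ι = ν + 1) :
    (Measure.pi fun _ : ι => gaussianReal 0 1).map
      (fun w => (Real.sqrt (Fintype.card ι : ℝ) * sampleMean Finset.univ w,
        ∑ i, (w i - sampleMean Finset.univ w) ^ 2))
      = (gaussianReal 0 1).prod (chiSquared ν) := by
  have hne : (Finset.univ : Finset ι).Nonempty := by
    rw [← Finset.card_pos, Finset.card_univ, hν]; omega
  have hpos : (0 : ℝ) < Fintype.card ι := by rw [hν]; positivity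
  obtain ⟨b, hb⟩ := exists_orthonormalBasis_const ι hν
  -- The sum of squared deviations is the squared length of the component orthogonal to `b 0`.
  let F : EuclideanSpace ℝ ι → ℝ × ℝ :=
    fun z => (inner ℝ (b 0) z, ‖z‖ ^ 2 - inner ℝ (b 0) z ^ 2)
  have hF : Measurable F := by fun_prop
  have h1 : (fun w : ι → ℝ => (Real.sqrt (Fintype.card ι : ℝ) * sampleMean Finset.univ w,
        ∑ i, (w i - sampleMean Finset.univ w) ^ 2)) = F ∘ WithLp.toLp 2 := by
    funext w
    have hin : inner ℝ (b 0) (WithLp.toLp 2 w)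
        = Real.sqrt (Fintype.card ι : ℝ) * sampleMean Finset.univ w := by
      rw [hb]
      simp only [PiLp.inner_apply, sampleMean, Finset.card_univ]
      simp only [RCLike.inner_apply, conj_trivial, ← Finset.sum_mul]
      rw [mul_div_assoc', mul_comm, inv_mul_eq_div,
        div_eq_div_iff (Real.sqrt_pos.2 hpos).ne' hpos.ne']
      nth_rewrite 1 [← Real.mul_self_sqrt hpos.le]
      ring
    simp only [Function.comp, F, hin]
    rw [sum_sub_sampleMean_sq _ _ hne, mul_pow, Real.sq_sqrt hpos.le,
      EuclideanSpace.norm_sq_eq]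
    simp
  -- Rotation invariance: the coordinates in the basis `b` are again independent standard normals,
  -- and `F` splits into coordinate `0` and the squares of the others.
  rw [h1, ← Measure.map_map hF (by fun_prop), map_pi_eq_stdGaussian,
    stdGaussian_eq_map_pi_orthonormalBasis b, Measure.map_map hF (by fun_prop)]
  have h2 : F ∘ (fun x : Fin (ν + 1) → ℝ => ∑ i, x i • b i)
      = (Prod.map id fun w : Fin ν → ℝ => ∑ i, w i ^ 2) ∘
        MeasurableEquiv.piFinSuccAbove (fun _ => ℝ) 0 := by
    funext x
    have hin : ∀ j, inner ℝ (b j) (∑ i, x i • b i) = x j := by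
      intro j
      rw [inner_sum]
      simp [inner_smul_right, b.inner_eq_ite]
    have hn : ‖∑ i, x i • b i‖ ^ 2 = ∑ i, x i ^ 2 := by
      rw [← b.sum_sq_norm_inner_right]
      simp [hin]
    simp only [Function.comp, F, hin, hn]
    rw [Fin.sum_univ_succ]
    simp [MeasurableEquiv.piFinSuccAbove, Fin.tail]
  rw [h2, ← Measure.map_map (by fun_prop) (by fun_prop),
    (measurePreserving_piFinSuccAbove (fun _ => gaussianReal 0 1) 0).map_eq,
    ← Measure.map_prod_map _ _ measurable_id (by fun_prop), Measure.map_id]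
  rfl

/-- A vanishing sum of squares forces the first normal coordinate to be `0`, a null event. This
keeps the default value of division by zero out of the `t` statistic. -/
theorem chiSquared_Iic_zero {ν : ℕ} (hν : ν ≠ 0) : chiSquared ν (Set.Iic 0) = 0 := by
  obtain ⟨ν, rfl⟩ := Nat.exists_eq_succ_of_ne_zero hν
  rw [chiSquared, Measure.map_apply (by fun_prop) measurableSet_Iic]
  have : NullSingletonClass (gaussianReal 0 1) := nullSingletonClass_gaussianReal one_ne_zero
  refine measure_mono_null (t := Function.eval 0 ⁻¹' {0}) ?_
    (((measurePreserving_eval (fun _ : Fin (ν + 1) => gaussianReal 0 1) 0).measure_preimage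
      (measurableSet_singleton _).nullMeasurableSet).trans (measure_singleton _))
  intro w hw
  have hw' : ∑ i, w i ^ 2 = 0 :=
    le_antisymm hw (Finset.sum_nonneg fun i _ => sq_nonneg _)
  have := (Finset.sum_eq_zero_iff_of_nonneg fun i _ => sq_nonneg (w i)).1 hw' 0 (Finset.mem_univ _)
  simpa using this

/-- Right-continuity of the distribution function makes the infimum attained, so continuity of
Student's law is not needed. -/
theorem le_studentT_Iic_tQuantile {p : ℝ} (hp : p ∈ Set.Ioo (0 : ℝ) 1) (ν : ℕ) :
    p ≤ (studentT ν).real (Set.Iic (tQuantile p ν)) := by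
  set F := cdf (studentT ν) with hF
  have hset : {x : ℝ | p ≤ (studentT ν).real (Set.Iic x)} = {x | p ≤ F x} := by
    ext x; simp [hF, cdf_eq_real]
  rw [tQuantile, hset, ← cdf_eq_real]
  have hne : {x | p ≤ F x}.Nonempty := by
    obtain ⟨x, hx⟩ := ((tendsto_cdf_atTop (studentT ν)).eventually (lt_mem_nhds hp.2)).exists
    exact ⟨x, hx.le⟩
  have hright := (F.right_continuous (sInf {x | p ≤ F x})).mono Set.Ioi_subset_Ici_self
  refine ge_of_tendsto hright ?_
  filter_upwards [self_mem_nhdsWithin] with x hx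
  obtain ⟨y, hy, hyx⟩ := exists_lt_of_csInf_lt hne hx
  exact le_trans hy (F.mono hyx.le)

/-- By the symmetry of `Z`, the event has the probability of `Z / √(V / ν) > t`, which the choice of
the quantile bounds by `δ`. Keeping it free of division matches the form of the `t`-test bound. -/
theorem prod_chiSquared_lt_neg_tQuantile {δ : ℝ} (hδ : δ ∈ Set.Ioo (0 : ℝ) 1) {ν : ℕ}
    (hν : ν ≠ 0) :
    ((gaussianReal 0 1).prod (chiSquared ν)).real
      {p | p.1 + Real.sqrt (p.2 / ν) * tQuantile (1 - δ) ν < 0} ≤ δ := by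
  set t := tQuantile (1 - δ) ν with ht
  set Q := (gaussianReal 0 1).prod (chiSquared ν) with hQ
  have hneg : MeasurePreserving (Prod.map (fun x : ℝ => -x) (id : ℝ → ℝ)) Q Q := by
    refine ⟨by fun_prop, ?_⟩
    rw [hQ, ← Measure.map_prod_map _ _ (by fun_prop) measurable_id, Measure.map_id,
      gaussianReal_map_neg, neg_zero]
  have hmeas : MeasurableSet {p : ℝ × ℝ | p.1 + Real.sqrt (p.2 / ν) * t < 0} :=
    measurableSet_lt (by fun_prop) measurable_const
  have hnull : Q {p | p.2 ≤ 0} = 0 := by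
    have : {p : ℝ × ℝ | p.2 ≤ 0} = Set.univ ×ˢ Set.Iic 0 := by ext; simp
    rw [this, hQ, Measure.prod_prod, chiSquared_Iic_zero hν, mul_zero]
  have hT : (studentT ν).real (Set.Ioi t) ≤ δ := by
    have h1 := le_studentT_Iic_tQuantile (p := 1 - δ) ⟨by linarith [hδ.2], by linarith [hδ.1]⟩ ν
    rw [← Set.compl_Iic, probReal_compl_eq_one_sub measurableSet_Iic]
    linarith
  refine le_trans ?_ hT
  rw [studentT, map_measureReal_apply (by fun_prop) measurableSet_Ioi, ← hQ,
    measureReal_def, measureReal_def]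
  refine ENNReal.toReal_mono (measure_ne_top _ _) ?_
  -- Replace `Z` by `-Z`; off the null set `V ≤ 0` the inequality may then be divided by `√(V / ν)`.
  rw [← hneg.measure_preimage hmeas.nullMeasurableSet]
  refine measure_mono_ae ?_
  have : ∀ᵐ p ∂Q, ¬ p.2 ≤ 0 := by rw [ae_iff]; simpa using hnull
  filter_upwards [this] with p hp hlt
  have hν' : (0 : ℝ) < ν := by exact_mod_cast Nat.pos_of_ne_zero hν
  have hs : 0 < Real.sqrt (p.2 / ν) := Real.sqrt_pos.2 (div_pos (not_le.1 hp) hν')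
  have hlt' : -p.1 + Real.sqrt (p.2 / ν) * t < 0 := hlt
  change t < p.1 / Real.sqrt (p.2 / ν)
  rw [lt_div_iff₀ hs]
  linarith

theorem sampleMean_const_add_mul {ι : Type*} {s : Finset ι} (hs : s.Nonempty) (g r : ℝ)
    (w : ι → ℝ) : sampleMean s (fun i => g + r * w i) = g + r * sampleMean s w := by
  have hm : (s.card : ℝ) ≠ 0 := by exact_mod_cast hs.card_pos.ne'
  simp only [sampleMean, Finset.sum_add_distrib, Finset.sum_const, nsmul_eq_mul, ← Finset.mul_sum]
  field_simp

theorem sampleStd_const_add_mul {ι : Type*} {s : Finset ι} (hs : s.Nonempty) (g : ℝ) {r : ℝ}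
    (hr : 0 ≤ r) (w : ι → ℝ) : sampleStd s (fun i => g + r * w i) = r * sampleStd s w := by
  have h : ∀ i, g + r * w i - (g + r * sampleMean s w) = r * (w i - sampleMean s w) :=
    fun i => by ring
  simp only [sampleStd, sampleMean_const_add_mul hs, h, mul_pow, ← Finset.mul_sum, mul_div_assoc]
  rw [Real.sqrt_mul (sq_nonneg _), Real.sqrt_sq hr]

theorem measurable_sampleMean {ι : Type*} (s : Finset ι) :
    Measurable fun z : ι → ℝ => sampleMean s z := by
  unfold sampleMean; fun_prop

theorem measurable_sampleStd {ι : Type*} (s : Finset ι) :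
    Measurable fun z : ι → ℝ => sampleStd s z := by
  have := measurable_sampleMean s
  unfold sampleStd; fun_prop

/-- The one-sided `t`-test bound is valid for a standard normal sample. -/
theorem pi_gaussianReal_ttest_lt {ι : Type*} [Fintype ι] (hι : 2 ≤ Fintype.card ι) {δ : ℝ}
    (hδ : δ ∈ Set.Ioo (0 : ℝ) 1) :
    (Measure.pi fun _ : ι => gaussianReal 0 1).real
      {w | sampleMean Finset.univ w + sampleStd Finset.univ w / Real.sqrt (Fintype.card ι : ℝ)
        * tQuantile (1 - δ) (Fintype.card ι - 1) < 0} ≤ δ := by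
  obtain ⟨ν, hν⟩ : ∃ ν, Fintype.card ι = ν + 1 := ⟨Fintype.card ι - 1, by omega⟩
  have hν0 : ν ≠ 0 := by omega
  have hpos : (0 : ℝ) < Fintype.card ι := by rw [hν]; positivity
  have hsub : Fintype.card ι - 1 = ν := by omega
  refine le_trans (le_of_eq ?_) (prod_chiSquared_lt_neg_tQuantile hδ hν0)
  have hm := measurable_sampleMean (Finset.univ : Finset ι)
  rw [← map_sampleMean_sumSq hν, map_measureReal_apply (by fun_prop)
    (measurableSet_lt (by fun_prop) measurable_const), hsub]
  congr 1
  ext w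
  have hs := Real.sqrt_pos.2 hpos
  have hstd : sampleStd Finset.univ w
      = Real.sqrt ((∑ i, (w i - sampleMean Finset.univ w) ^ 2) / ν) := by
    rw [sampleStd, Finset.card_univ, hν]; simp
  simp only [Set.mem_ofPred_eq, Set.preimage_ofPred_eq, ← hstd]
  -- Multiplying by `√m` turns the mean into the standard normal coordinate and cancels the `√m`
  -- under the standard deviation.
  rw [← mul_lt_mul_iff_right₀ hs, mul_zero]
  field_simp

/-- The one-sided `t`-test bound is valid for a normal sample. -/
theorem measureReal_ttest_lt {Ω ι : Type*} [MeasurableSpace Ω] {Q : Measure Ω}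
    [IsProbabilityMeasure Q] {Z : ι → Ω → ℝ} {A : Finset ι} (hA : 2 ≤ A.card)
    (hZ : ∀ i, Measurable (Z i)) (hind : iIndepFun Z Q) {g : ℝ} {v : NNReal}
    (hlaw : ∀ i ∈ A, Q.map (Z i) = gaussianReal g v) {δ : ℝ} (hδ : δ ∈ Set.Ioo (0 : ℝ) 1) :
    Q.real {ω | sampleMean A (fun i => Z i ω) + sampleStd A (fun i => Z i ω)
      / Real.sqrt (A.card : ℝ) * tQuantile (1 - δ) (A.card - 1) < g} ≤ δ := by
  have hne : (Finset.univ : Finset A).Nonempty := by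
    rw [← Finset.card_pos, Finset.card_univ, Fintype.card_coe]; omega
  have hmean : ∀ z : ι → ℝ, sampleMean A z = sampleMean Finset.univ fun i : A => z i := by
    intro z
    simp only [sampleMean, Finset.card_univ, Fintype.card_coe]
    rw [Finset.sum_coe_sort A z]
  have hstd : ∀ z : ι → ℝ, sampleStd A z = sampleStd Finset.univ fun i : A => z i := by
    intro z
    simp only [sampleStd, Finset.card_univ, Fintype.card_coe, hmean]
    rw [Finset.sum_coe_sort A fun i => (z i - sampleMean Finset.univ fun i : A => z i) ^ 2]
  have hpi : Q.map (fun ω (i : A) => Z i ω) = Measure.pi fun _ : A => gaussianReal g v := by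
    rw [(iIndepFun_iff_map_fun_eq_pi_map fun i : A => (hZ i).aemeasurable).1
      (hind.precomp Subtype.val_injective)]
    congr 1
    funext i
    exact hlaw i i.2
  -- This representation also covers `v = 0`, where the law is a point mass.
  have hg : gaussianReal g v = (gaussianReal 0 1).map fun w => g + Real.sqrt v * w := by
    have : (fun w : ℝ => g + Real.sqrt v * w) = (fun x => g + x) ∘ fun w => Real.sqrt v * w := rfl
    rw [this, ← Measure.map_map (by fun_prop) (by fun_prop), gaussianReal_map_const_mul,
      gaussianReal_map_const_add]
    congr 1
    · simp
    · ext; simp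
  have hprob : IsProbabilityMeasure ((gaussianReal 0 1).map fun w => g + Real.sqrt v * w) := by
    rw [← hg]; infer_instance
  rw [hg, ← Measure.pi_map_pi fun _ => Measurable.aemeasurable (by fun_prop)] at hpi
  have hm := measurable_sampleMean (Finset.univ : Finset A)
  have hs := measurable_sampleStd (Finset.univ : Finset A)
  let S : Set (A → ℝ) := {w | sampleMean Finset.univ w + sampleStd Finset.univ w
      / Real.sqrt (A.card : ℝ) * tQuantile (1 - δ) (A.card - 1) < g}
  have hS : MeasurableSet S := measurableSet_lt (by fun_prop) measurable_const
  have h1 : {ω | sampleMean A (fun i => Z i ω) + sampleStd A (fun i => Z i ω)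
      / Real.sqrt (A.card : ℝ) * tQuantile (1 - δ) (A.card - 1) < g}
      = (fun ω (i : A) => Z i ω) ⁻¹' S := by
    ext ω; simp only [hmean, hstd, S, Set.mem_ofPred_eq, Set.preimage_ofPred_eq]
  rw [h1, ← map_measureReal_apply (by fun_prop) hS, hpi, map_measureReal_apply (by fun_prop) hS]
  refine le_trans (measureReal_mono ?_)
    (pi_gaussianReal_ttest_lt (ι := A) (by simpa using hA) hδ)
  intro w hw
  simp only [S, Set.mem_preimage, Set.mem_ofPred_eq, sampleMean_const_add_mul hne,
    sampleStd_const_add_mul hne g (Real.sqrt_nonneg _)] at hw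
  simp only [Set.mem_ofPred_eq, Fintype.card_coe]
  -- Only multiplication by `√v ≥ 0` is used, never division, so variance `0` needs no separate
  -- case.
  by_contra hcon
  have := mul_nonneg (Real.sqrt_nonneg v) (not_lt.1 hcon)
  have h2 : Real.sqrt v * (sampleMean Finset.univ w + sampleStd Finset.univ w
      / Real.sqrt (A.card : ℝ) * tQuantile (1 - δ) (A.card - 1))
      = Real.sqrt v * sampleMean Finset.univ w + Real.sqrt v * sampleStd Finset.univ w
      / Real.sqrt (A.card : ℝ) * tQuantile (1 - δ) (A.card - 1) := by ring
  rw [h2] at this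
  linarith

/-! ### Normality of a sample from normality of its average -/

/-- The quotient `φ / ψ` is continuous with values in the finite set of `m`-th roots of unity, hence
constant on the connected line, and it is `1` at `0`. -/
theorem eq_of_pow_eq_pow_of_continuous {m : ℕ} (hm : m ≠ 0) {φ ψ : ℝ → ℂ} (hφ : Continuous φ)
    (hψ : Continuous ψ) (hψ0 : ∀ t, ψ t ≠ 0) (h : ∀ t, φ t ^ m = ψ t ^ m) (h0 : φ 0 = ψ 0) :
    φ = ψ := by
  let T : Set ℂ := {z | z ^ m = 1}
  have hT : T.Finite := by
    refine (Polynomial.nthRoots m (1 : ℂ)).toFinset.finite_toSet.subset fun z hz => ?_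
    simp only [Finset.mem_coe, Multiset.mem_toFinset]
    exact (Polynomial.mem_nthRoots (Nat.pos_of_ne_zero hm)).2 hz
  have := hT.to_subtype
  have hTd : IsDiscrete T := ⟨inferInstance⟩
  funext t
  have hc : Continuous fun t => φ t / ψ t := hφ.div hψ hψ0
  have hmaps : Set.MapsTo (fun t => φ t / ψ t) Set.univ T := fun t _ => by
    change (φ t / ψ t) ^ m = 1
    rw [div_pow, h t, div_self (pow_ne_zero _ (hψ0 t))]
  have key := isPreconnected_univ.constant_of_mapsTo hTd hc.continuousOn hmaps
    (Set.mem_univ t) (Set.mem_univ 0)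
  have h00 : φ 0 / ψ 0 = 1 := by rw [h0, div_self (hψ0 0)]
  simp only [h00] at key
  rwa [div_eq_one_iff_eq (hψ0 t)] at key

theorem charFun_gaussianReal_ne_zero (a : ℝ) (v : NNReal) (t : ℝ) :
    charFun (gaussianReal a v) t ≠ 0 := by
  rw [charFun_gaussianReal]; exact Complex.exp_ne_zero _

/-- If the average of independent copies is normal, then so is each copy. -/
theorem exists_eq_gaussianReal_of_charFun_pow {ρ : Measure ℝ} [IsProbabilityMeasure ρ] {m : ℕ}
    (hm : m ≠ 0) {a : ℝ} {v : NNReal}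
    (h : ∀ t, charFun ρ t ^ m = charFun (gaussianReal a v) (m * t)) :
    ∃ (g : ℝ) (w : NNReal), ρ = gaussianReal g w := by
  -- Averaging `m` copies keeps the mean and divides the variance by `m`, whence the variance `m *
  -- v`.
  refine ⟨a, m * v, Measure.ext_of_charFun ?_⟩
  refine eq_of_pow_eq_pow_of_continuous hm continuous_charFun continuous_charFun
    (charFun_gaussianReal_ne_zero _ _) (fun t => ?_) (by simp [charFun_zero])
  rw [h, charFun_gaussianReal, charFun_gaussianReal, ← Complex.exp_nat_mul]
  congr 1
  push_cast
  ring

theorem charFun_map_sampleMean {Ω ι : Type*} [MeasurableSpace Ω] {Q : Measure Ω}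
    [IsProbabilityMeasure Q] {Z : ι → Ω → ℝ} (A : Finset ι) (hZ : ∀ i, Measurable (Z i))
    (hind : iIndepFun Z Q) {ρ : Measure ℝ} (hlaw : ∀ i ∈ A, Q.map (Z i) = ρ) (t : ℝ) :
    charFun (Q.map fun ω => sampleMean A fun i => Z i ω) t
      = charFun ρ ((A.card : ℝ)⁻¹ * t) ^ A.card := by
  have h1 : (fun ω => sampleMean A fun i => Z i ω)
      = fun ω => (A.card : ℝ)⁻¹ * ∑ i ∈ A, Z i ω := by
    funext ω; rw [sampleMean, div_eq_inv_mul]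
  have h2 := iIndepFun.charFun_map_fun_finsetSum_eq_prod (s := A) (X := Z) (P := Q)
    (fun i _ => (hZ i).aemeasurable) (hind.precomp (g := ((↑) : A → ι)) Subtype.val_injective)
  rw [h1, charFun_map_mul_comp (Finset.measurable_sum _ fun i _ => hZ i).aemeasurable, h2,
    Finset.prod_congr rfl fun i hi => by rw [hlaw i hi], Finset.prod_const, Pi.pow_apply]

/-! ### Hoeffding's bound -/

/-- Chernoff's method: a variable with values in `[a, b]` is sub-Gaussian with parameter `((b - a) /
2) ^ 2`, and the margin is the one at which the tail bound equals `δ`. -/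
theorem measureReal_hoeffding_lt {Ω ι : Type*} [MeasurableSpace Ω] {Q : Measure Ω}
    [IsProbabilityMeasure Q] {Z : ι → Ω → ℝ} {A : Finset ι} (hA : A.Nonempty)
    (hZ : ∀ i, Measurable (Z i)) (hind : iIndepFun Z Q) {ρ : Measure ℝ}
    (hlaw : ∀ i ∈ A, Q.map (Z i) = ρ) {a b : ℝ} (hab : ∀ᵐ x ∂ρ, x ∈ Set.Icc a b)
    {δ : ℝ} (hδ : δ ∈ Set.Ioo (0 : ℝ) 1) :
    Q.real {ω | sampleMean A (fun i => Z i ω)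
      + (b - a) * Real.sqrt (Real.log (1 / δ) / (2 * (A.card : ℝ))) < ∫ x, x ∂ρ} ≤ δ := by
  set g := ∫ x, x ∂ρ with hg
  have hm : (0 : ℝ) < A.card := by exact_mod_cast hA.card_pos
  have hZab : ∀ i ∈ A, ∀ᵐ ω ∂Q, Z i ω ∈ Set.Icc a b := fun i hi => by
    rw [← hlaw i hi] at hab
    exact ae_of_ae_map (hZ i).aemeasurable hab
  have hZg : ∀ i ∈ A, ∫ ω, Z i ω ∂Q = g := fun i hi => by
    rw [hg, ← hlaw i hi, integral_map (hZ i).aemeasurable (by fun_prop)]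
  obtain ⟨i₀, hi₀⟩ := hA
  have hle : a ≤ b := by
    obtain ⟨ω, hω⟩ := (hZab i₀ hi₀).exists
    exact hω.1.trans hω.2
  have hlog : 0 ≤ Real.log (1 / δ) :=
    Real.log_nonneg (by rw [le_div_iff₀ hδ.1]; linarith [hδ.2])
  rcases hle.eq_or_lt with rfl | hlt
  -- If `a = b` the tail exponent degenerates to `0 / 0`; but then the sample is almost surely
  -- constant, equal to its mean, and the strict inequality fails.
  · refine le_trans (le_of_eq ?_) hδ.1.le
    have hall : ∀ᵐ ω ∂Q, ∀ i ∈ A, Z i ω = a := by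
      rw [Filter.eventually_all_finset]
      exact fun i hi => (hZab i hi).mono fun ω hω => le_antisymm hω.2 hω.1
    have hga : g = a := by
      rw [← hZg i₀ hi₀, integral_congr_ae (g := fun _ => a) (hall.mono fun ω hω => hω i₀ hi₀)]
      simp
    rw [measureReal_eq_zero_iff, measure_eq_zero_iff_ae_notMem]
    filter_upwards [hall] with ω hω
    have : sampleMean A (fun i => Z i ω) = a := by
      rw [sampleMean, Finset.sum_congr rfl hω, Finset.sum_const, nsmul_eq_mul]
      field_simp
    simp [this, hga]
  · set ε := (b - a) * Real.sqrt (Real.log (1 / δ) / (2 * (A.card : ℝ))) with hε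
    have hε0 : 0 ≤ ε := mul_nonneg (by linarith) (Real.sqrt_nonneg _)
    have hsub : ∀ i ∈ A, HasSubgaussianMGF (fun ω => g - Z i ω) ((‖b - a‖₊ / 2) ^ 2) Q := by
      intro i hi
      have := (hasSubgaussianMGF_of_mem_Icc (hZ i).aemeasurable (hZab i hi)).neg
      refine this.congr (ae_of_all _ fun ω => ?_)
      simp [hZg i hi]
    have hind' : iIndepFun (fun i ω => g - Z i ω) Q :=
      hind.comp (fun _ x => g - x) fun _ => by fun_prop
    have h := HasSubgaussianMGF.measure_sum_ge_le_of_iIndepFun hind' hsub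
      (mul_nonneg hm.le hε0)
    refine (measureReal_mono ?_).trans (h.trans (le_of_eq ?_))
    · intro ω hω
      simp only [Set.mem_ofPred_eq] at hω ⊢
      have h2 : ∑ i ∈ A, Z i ω = A.card * sampleMean A fun i => Z i ω := by
        rw [sampleMean]; field_simp
      rw [Finset.sum_sub_distrib, Finset.sum_const, nsmul_eq_mul, h2, ← mul_sub]
      exact mul_le_mul_of_nonneg_left (by linarith) hm.le
    -- With total parameter `m (b - a)² / 4` the exponent is `-2 m ε² / (b - a)²`, which is `-ln
    -- (1/δ)`.
    · have h3 : -(A.card * ε) ^ 2 / (2 * ((∑ i ∈ A, (‖b - a‖₊ / 2) ^ 2 : NNReal) : ℝ))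
          = -Real.log (1 / δ) := by
        rw [Finset.sum_const, nsmul_eq_mul]
        push_cast
        rw [hε, mul_pow, mul_pow, Real.sq_sqrt (by positivity), Real.norm_eq_abs,
          div_pow, sq_abs]
        have : b - a ≠ 0 := by linarith
        field_simp
      push_cast at h3 ⊢
      rw [h3, one_div, Real.log_inv, neg_neg, Real.exp_log hδ.1]

/-! ### A random subsample of independent observations -/

/-- Total probability over the values of `S`; null fibres carry no weight, so nothing is asked of
them. -/
theorem measure_le_of_cond_fiber_le {Ω α : Type*} [MeasurableSpace Ω] [Fintype α]
    [MeasurableSpace α] [DiscreteMeasurableSpace α] {P : Measure Ω} [IsProbabilityMeasure P]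
    {S : Ω → α} (hS : Measurable S) {B : Set Ω} {c : ENNReal}
    (h : ∀ a, P (S ⁻¹' {a}) ≠ 0 → cond P (S ⁻¹' {a}) B ≤ c) : P B ≤ c := by
  have h1 : ∑ a, P (S ⁻¹' {a}) = 1 := by
    rw [sum_measure_preimage_singleton _ fun a _ => hS (measurableSet_singleton a)]
    simp
  rw [← sum_meas_smul_cond_fiber hS P]
  simp only [Measure.coe_finsetSum, Measure.coe_smul, Finset.sum_apply, Pi.smul_apply, smul_eq_mul]
  calc ∑ a, P (S ⁻¹' {a}) * cond P (S ⁻¹' {a}) B ≤ ∑ a, P (S ⁻¹' {a}) * c := by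
        refine Finset.sum_le_sum fun a _ => ?_
        by_cases ha : P (S ⁻¹' {a}) = 0
        · simp [ha]
        · gcongr
          exact h a ha
    _ = c := by rw [← Finset.sum_mul, h1, one_mul]

theorem measure_eq_of_cond_fiber_eq {Ω α : Type*} [MeasurableSpace Ω] [Fintype α]
    [MeasurableSpace α] [DiscreteMeasurableSpace α] {P : Measure Ω} [IsProbabilityMeasure P]
    {S : Ω → α} (hS : Measurable S) {B : Set Ω} {c : ENNReal}
    (h : ∀ a, P (S ⁻¹' {a}) ≠ 0 → cond P (S ⁻¹' {a}) B = c) : P B = c := by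
  have h1 : ∑ a, P (S ⁻¹' {a}) = 1 := by
    rw [sum_measure_preimage_singleton _ fun a _ => hS (measurableSet_singleton a)]
    simp
  rw [← sum_meas_smul_cond_fiber hS P]
  simp only [Measure.coe_finsetSum, Measure.coe_smul, Finset.sum_apply, Pi.smul_apply, smul_eq_mul]
  calc ∑ a, P (S ⁻¹' {a}) * cond P (S ⁻¹' {a}) B = ∑ a, P (S ⁻¹' {a}) * c := by
        refine Finset.sum_congr rfl fun a _ => ?_
        by_cases ha : P (S ⁻¹' {a}) = 0
        · simp [ha]
        · rw [h a ha]
    _ = c := by rw [← Finset.sum_mul, h1, one_mul]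

/-- The random set of the indices that are flagged `true`. -/
def trueIdx {Ω ι : Type*} [Fintype ι] (C : ι → Ω → Bool) (ω : Ω) : Finset ι :=
  Finset.univ.filter fun i => C i ω = true

section Subsample

/-- Fixing the whole index set prescribes every flag separately. This product form lets conditioning
preserve independence, which fixing only the number of flags would not give directly. -/
theorem setOf_trueIdx_eq {Ω ι : Type*} [Fintype ι] [DecidableEq ι] (C : ι → Ω → Bool) (A : Finset ι) :
    {ω | trueIdx C ω = A} = ⋂ i, C i ⁻¹' {decide (i ∈ A)} := by
  ext ω
  simp only [trueIdx, Finset.ext_iff, Finset.mem_filter, Finset.mem_univ, true_and,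
    Set.mem_iInter, Set.mem_preimage, Set.mem_singleton_iff, Set.mem_ofPred_eq]
  refine forall_congr' fun i => ?_
  by_cases hi : i ∈ A <;> simp [hi]

variable {Ω ι : Type*} [MeasurableSpace Ω] [Fintype ι] {P : Measure Ω} {Z : ι → Ω → ℝ}
  {C : ι → Ω → Bool}

theorem measurable_trueIdx (hC : ∀ i, Measurable (C i)) :
    Measurable[_, (⊤ : MeasurableSpace (Finset ι))] (trueIdx C) := by
  classical
  let _ : MeasurableSpace (Finset ι) := ⊤
  refine measurable_to_countable' fun A => ?_
  have := setOf_trueIdx_eq C A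
  change MeasurableSet {ω | trueIdx C ω = A}
  rw [this]
  exact MeasurableSet.iInter fun i => hC i (measurableSet_singleton _)

theorem measure_flag_ne_zero {A : Finset ι} (hA : P {ω | trueIdx C ω = A} ≠ 0) {i : ι}
    (hi : i ∈ A) : P (C i ⁻¹' {true}) ≠ 0 := by
  refine fun h0 => hA (measure_mono_null (fun ω hω => ?_) h0)
  rw [Set.mem_ofPred_eq] at hω
  rw [← hω, trueIdx, Finset.mem_filter] at hi
  exact hi.2

theorem iIndepFun_cond_trueIdx [IsProbabilityMeasure P] (hC : ∀ i, Measurable (C i))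
    (hind : iIndepFun (fun i ω => (Z i ω, C i ω)) P)
    {A : Finset ι} (hA : P {ω | trueIdx C ω = A} ≠ 0) :
    iIndepFun Z (cond P {ω | trueIdx C ω = A}) := by
  classical
  rw [setOf_trueIdx_eq] at hA ⊢
  refine iIndepFun.cond hC hind (fun i h0 => hA ?_) fun i => measurableSet_singleton _
  exact measure_mono_null (Set.iInter_subset _ i) h0

/-- The other flags are independent of the pair `(Z i, C i)`, so only the observation's own flag
affects its conditional law. -/
theorem map_cond_trueIdx [IsProbabilityMeasure P] (hZ : ∀ i, Measurable (Z i))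
    (hC : ∀ i, Measurable (C i)) (hind : iIndepFun (fun i ω => (Z i ω, C i ω)) P)
    {ρ : Measure ℝ} (hρ : ∀ i, P (C i ⁻¹' {true}) ≠ 0 → (cond P (C i ⁻¹' {true})).map (Z i) = ρ)
    {A : Finset ι} (hA : P {ω | trueIdx C ω = A} ≠ 0) {i : ι} (hi : i ∈ A) :
    (cond P {ω | trueIdx C ω = A}).map (Z i) = ρ := by
  classical
  rw [← hρ i (measure_flag_ne_zero hA hi)]
  rw [setOf_trueIdx_eq] at hA ⊢
  ext B hB
  rw [Measure.map_apply (hZ i) hB, Measure.map_apply (hZ i) hB]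
  have := cond_iInter (s := {i}) (f := fun i => Z i ⁻¹' B) (t := fun i => {decide (i ∈ A)})
    hC hind (fun j _ => ⟨B, hB, rfl⟩)
    (fun j _ h0 => hA (measure_mono_null (Set.iInter_subset _ j) h0))
    fun j => measurableSet_singleton _
  simpa [hi] using this

/-- If the average over the flagged observations is normal given that there are `m ≥ 1` of them,
then so is each flagged observation. -/
theorem exists_eq_gaussianReal_of_isGaussian_mean [IsProbabilityMeasure P]
    (hZ : ∀ i, Measurable (Z i)) (hC : ∀ i, Measurable (C i))
    (hind : iIndepFun (fun i ω => (Z i ω, C i ω)) P) {ρ : Measure ℝ} [IsProbabilityMeasure ρ]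
    (hρ : ∀ i, P (C i ⁻¹' {true}) ≠ 0 → (cond P (C i ⁻¹' {true})).map (Z i) = ρ)
    {m : ℕ} (hm : m ≠ 0) (hPm : P {ω | (trueIdx C ω).card = m} ≠ 0)
    (hG : IsGaussian ((cond P {ω | (trueIdx C ω).card = m}).map
      fun ω => sampleMean (trueIdx C ω) fun i => Z i ω)) :
    ∃ (g : ℝ) (v : NNReal), ρ = gaussianReal g v := by
  classical
  let _ : MeasurableSpace (Finset ι) := ⊤
  have : DiscreteMeasurableSpace (Finset ι) := ⟨fun _ => trivial⟩
  have hS : Measurable (trueIdx C) := measurable_trueIdx hC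
  have hmeas : MeasurableSet {ω | (trueIdx C ω).card = m} :=
    hS (MeasurableSet.of_discrete (s := {A : Finset ι | A.card = m}))
  have hmean : Measurable fun ω => sampleMean (trueIdx C ω) fun i => Z i ω := by
    refine (measurable_from_prod_countable_right
      (f := fun p : Finset ι × (ι → ℝ) => sampleMean p.1 p.2)
      fun A => measurable_sampleMean A).comp (hS.prodMk (measurable_pi_lambda _ hZ))
  set Q := cond P {ω | (trueIdx C ω).card = m} with hQ
  have : IsProbabilityMeasure Q := cond_isProbabilityMeasure hPm
  set η := Q.map fun ω => sampleMean (trueIdx C ω) fun i => Z i ω with hη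
  have : IsProbabilityMeasure η := Measure.isProbabilityMeasure_map hmean.aemeasurable
  -- The index set determines its cardinality, so conditioning on both reduces to conditioning on
  -- the index set.
  have hfib : ∀ A, Q {ω | trueIdx C ω = A} ≠ 0 → A.card = m ∧ P {ω | trueIdx C ω = A} ≠ 0 ∧
      cond Q {ω | trueIdx C ω = A} = cond P {ω | trueIdx C ω = A} := by
    intro A hA
    have hAm : MeasurableSet {ω | trueIdx C ω = A} := hS (measurableSet_singleton A)
    have h1 : A.card = m := by
      by_contra hne
      refine hA ?_
      rw [hQ, cond_apply hmeas]
      have : {ω | (trueIdx C ω).card = m} ∩ {ω | trueIdx C ω = A} = ∅ := by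
        ext ω
        simp only [Set.mem_inter_iff, Set.mem_ofPred_eq, Set.mem_empty_iff_false, iff_false]
        rintro ⟨h, h'⟩
        exact hne (h' ▸ h)
      rw [this]; simp
    have h2 : {ω | (trueIdx C ω).card = m} ∩ {ω | trueIdx C ω = A} = {ω | trueIdx C ω = A} := by
      refine Set.inter_eq_right.2 fun ω hω => ?_
      rw [Set.mem_ofPred_eq] at hω ⊢
      rw [hω, h1]
    refine ⟨h1, fun h0 => hA (cond_absolutelyContinuous h0), ?_⟩
    rw [hQ, cond_cond_eq_cond_inter hmeas hAm, h2]
  -- The right side depends on `A` only through its size `m`: the law of the average given the count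
  -- is a mixture of identical laws, hence equal to any one of them.
  have hchar : ∀ A, Q {ω | trueIdx C ω = A} ≠ 0 → ∀ t,
      charFun ((cond Q {ω | trueIdx C ω = A}).map
        fun ω => sampleMean (trueIdx C ω) fun i => Z i ω) t = charFun ρ ((m : ℝ)⁻¹ * t) ^ m := by
    intro A hA t
    obtain ⟨h1, h2, h3⟩ := hfib A hA
    have : IsProbabilityMeasure (cond P {ω | trueIdx C ω = A}) := cond_isProbabilityMeasure h2
    rw [h3, ← h1, ← charFun_map_sampleMean A hZ (iIndepFun_cond_trueIdx hC hind h2)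
      (fun i hi => map_cond_trueIdx hZ hC hind hρ h2 hi)]
    congr 1
    refine Measure.map_congr ?_
    have hAm : MeasurableSet {ω | trueIdx C ω = A} := hS (measurableSet_singleton A)
    filter_upwards [ae_cond_mem hAm] with ω hω
    change trueIdx C ω = A at hω
    rw [hω]
  obtain ⟨A₀, hA₀⟩ : ∃ A, Q {ω | trueIdx C ω = A} ≠ 0 := by
    by_contra hcon
    push Not at hcon
    have : Q Set.univ ≤ 0 :=
      measure_le_of_cond_fiber_le hS (B := Set.univ) fun A hA => absurd (hcon A) hA
    simp at this
  have hη' : η = (cond Q {ω | trueIdx C ω = A₀}).map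
      fun ω => sampleMean (trueIdx C ω) fun i => Z i ω := by
    ext B hB
    rw [hη, Measure.map_apply hmean hB]
    refine measure_eq_of_cond_fiber_eq hS fun A hA => ?_
    have : IsProbabilityMeasure (cond Q {ω | trueIdx C ω = A}) := cond_isProbabilityMeasure hA
    have : IsProbabilityMeasure (cond Q {ω | trueIdx C ω = A₀}) := cond_isProbabilityMeasure hA₀
    have heq : (cond Q {ω | trueIdx C ω = A}).map
        (fun ω => sampleMean (trueIdx C ω) fun i => Z i ω)
        = (cond Q {ω | trueIdx C ω = A₀}).map
          fun ω => sampleMean (trueIdx C ω) fun i => Z i ω := by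
      refine Measure.ext_of_charFun (funext fun t => ?_)
      rw [hchar A hA, hchar A₀ hA₀]
    rw [← heq, Measure.map_apply hmean hB]
    rfl
  have hm' : (m : ℝ) ≠ 0 := by exact_mod_cast hm
  refine exists_eq_gaussianReal_of_charFun_pow hm (a := ∫ x, id x ∂η)
    (v := (Var[id; η]).toNNReal) fun t => ?_
  rw [← IsGaussian.eq_gaussianReal η hG, hη', hchar A₀ hA₀, ← mul_assoc, inv_mul_cancel₀ hm',
    one_mul]

end Subsample

/-! ### Importance sampling -/

/-- The importance weight `π_θ(x, ŷ) / β(x, ŷ)`. -/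
def weight {𝓧 𝓨 𝓣 Θ : Type*} [MeasurableSpace 𝓧] [MeasurableSpace 𝓨] [MeasurableSpace 𝓣]
    [MeasurableSpace Θ] {n k : ℕ} (E : Input 𝓧 𝓨 𝓣 Θ n k) (θ : Θ) (x : 𝓧) (y : 𝓨) : ℝ :=
  E.polProb θ x y / E.behavProb x y

theorem weight_nonneg {𝓧 𝓨 𝓣 Θ : Type*} [MeasurableSpace 𝓧] [MeasurableSpace 𝓨]
    [MeasurableSpace 𝓣] [MeasurableSpace Θ] {n k : ℕ} (E : Input 𝓧 𝓨 𝓣 Θ n k) (θ : Θ) (x : 𝓧)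
    (y : 𝓨) : 0 ≤ weight E θ x y :=
  div_nonneg measureReal_nonneg measureReal_nonneg

theorem measurable_weight {𝓧 𝓨 𝓣 Θ : Type*} [MeasurableSpace 𝓧] [MeasurableSpace 𝓨]
    [MeasurableSpace 𝓣] [MeasurableSpace Θ] [Countable 𝓨] [MeasurableSingletonClass 𝓨] {n k : ℕ}
    (E : Input 𝓧 𝓨 𝓣 Θ n k) : Measurable fun q : (Θ × 𝓧) × 𝓨 => weight E q.1.1 q.1.2 q.2 := by
  refine measurable_from_prod_countable_left fun y => ?_
  have h1 : Measurable fun q : Θ × 𝓧 => (E.pol q).real {y} :=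
    (E.pol.measurable_coe (measurableSet_singleton y)).ennreal_toReal
  have h2 : Measurable fun q : Θ × 𝓧 => (E.β q.2).real {y} :=
    ((E.β.measurable_coe (measurableSet_singleton y)).comp measurable_snd).ennreal_toReal
  exact h1.div h2

theorem measurable_weight_dataPoint {𝓧 𝓨 𝓣 Θ : Type*} [MeasurableSpace 𝓧] [MeasurableSpace 𝓨]
    [MeasurableSpace 𝓣] [MeasurableSpace Θ] [Countable 𝓨] [MeasurableSingletonClass 𝓨] {n k : ℕ}
    (E : Input 𝓧 𝓨 𝓣 Θ n k) :
    Measurable fun q : Θ × DataPoint 𝓧 𝓨 𝓣 => weight E q.1 q.2.1 q.2.2.2.2.1 :=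
  (measurable_weight E).comp
    (g := fun q : (Θ × 𝓧) × 𝓨 => weight E q.1.1 q.1.2 q.2)
    (f := fun q : Θ × DataPoint 𝓧 𝓨 𝓣 => ((q.1, q.2.1), q.2.2.2.2.1)) (by fun_prop)

/-- The set of the data points at which the condition `c` holds. -/
def flagSet {𝓧 𝓨 𝓣 : Type*} (c : 𝓧 × 𝓨 × 𝓣 → Bool) : Set (DataPoint 𝓧 𝓨 𝓣) :=
  {p | c (DataPoint.xyt p) = true}

theorem measurable_flag {𝓧 𝓨 𝓣 : Type*} [MeasurableSpace 𝓧] [MeasurableSpace 𝓨]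
    [MeasurableSpace 𝓣] {c : 𝓧 × 𝓨 × 𝓣 → Bool} (hc : Measurable c) :
    Measurable fun p : DataPoint 𝓧 𝓨 𝓣 => c (DataPoint.xyt p) := by
  unfold DataPoint.xyt; fun_prop

theorem measurableSet_flagSet {𝓧 𝓨 𝓣 : Type*} [MeasurableSpace 𝓧] [MeasurableSpace 𝓨]
    [MeasurableSpace 𝓣] {c : 𝓧 × 𝓨 × 𝓣 → Bool} (hc : Measurable c) :
    MeasurableSet (flagSet c) :=
  measurable_flag hc (measurableSet_singleton true)

section ImportanceSampling

variable {Ω₀ 𝓧 𝓨 𝓣 Θ : Type*} [MeasurableSpace Ω₀] [MeasurableSpace 𝓧] [MeasurableSpace 𝓨]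
  [MeasurableSpace 𝓣] [MeasurableSpace Θ] [Countable 𝓨] [MeasurableSingletonClass 𝓨]
  {μ : Measure Ω₀} [IsProbabilityMeasure μ] {X : Ω₀ → 𝓧} {Y : Ω₀ → 𝓨} {T : Ω₀ → 𝓣}

theorem condExp_preimage_ae_eq_of_hasCondDistrib {Yhat : Ω₀ → 𝓨} (hX : Measurable X)
    (hYhat : Measurable Yhat) {κ : Kernel 𝓧 𝓨} [IsMarkovKernel κ]
    (hκ : HasCondDistrib Yhat X κ μ) (y : 𝓨) :
    (μ⟦Yhat ⁻¹' {y} | MeasurableSpace.comap X inferInstance⟧)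
      =ᵐ[μ] fun ω => (κ (X ω)).real {y} := by
  have hne : Nonempty Ω₀ := nonempty_of_isProbabilityMeasure μ
  have : Nonempty 𝓨 := hne.map Yhat
  have h1 := condDistrib_ae_eq_condExp (μ := μ) hX hYhat (measurableSet_singleton y)
  have h2 : condDistrib Yhat X μ =ᵐ[μ.map X] κ :=
    condDistrib_ae_eq_of_measure_eq_compProd X hYhat.aemeasurable hκ.map_eq
  have h3 := ae_of_ae_map hX.aemeasurable h2
  refine h1.symm.trans ?_
  filter_upwards [h3] with ω hω
  rw [hω]

/-- The Markov property integrated over an event of `(X, Y, T)`, with the conditional probability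
given `X` replaced by the model kernel. -/
theorem measure_inter_preimage_of_markovProperty {Yhat : Ω₀ → 𝓨} (hX : Measurable X)
    (hY : Measurable Y) (hT : Measurable T) (hYhat : Measurable Yhat) {κ : Kernel 𝓧 𝓨}
    [IsMarkovKernel κ] (hκ : HasCondDistrib Yhat X κ μ) (hM : MarkovProperty μ X Y T Yhat) (y : 𝓨)
    {B : Set (𝓧 × 𝓨 × 𝓣)} (hB : MeasurableSet B) :
    μ (Yhat ⁻¹' {y} ∩ (fun ω => (X ω, Y ω, T ω)) ⁻¹' B)
      = ∫⁻ ω in (fun ω => (X ω, Y ω, T ω)) ⁻¹' B, κ (X ω) {y} ∂μ := by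
  have hV : Measurable fun ω => (X ω, Y ω, T ω) := by fun_prop
  have hS : MeasurableSet (Yhat ⁻¹' {y}) := hYhat (measurableSet_singleton y)
  have hκm : Measurable fun ω => κ (X ω) {y} :=
    (κ.measurable_coe (measurableSet_singleton y)).comp hX
  have h1 := (hM y).trans (condExp_preimage_ae_eq_of_hasCondDistrib hX hYhat hκ y)
  have h2 := setIntegral_condExp (μ := μ) hV.comap_le
    (f := (Yhat ⁻¹' {y}).indicator fun _ => (1 : ℝ))
    ((integrable_const _).indicator hS) (s := (fun ω => (X ω, Y ω, T ω)) ⁻¹' B) ⟨B, hB, rfl⟩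
  rw [integral_congr_ae (ae_restrict_of_ae h1)] at h2
  rw [integral_indicator_const _ hS, smul_eq_mul, mul_one, measureReal_restrict_apply hS] at h2
  have h3 : ∫⁻ ω in (fun ω => (X ω, Y ω, T ω)) ⁻¹' B, κ (X ω) {y} ∂μ ≠ ⊤ := by
    refine ((lintegral_mono (g := fun _ => 1) fun ω => prob_le_one).trans_lt ?_).ne
    simp [measure_lt_top]
  rw [← ENNReal.toReal_eq_toReal_iff' (measure_ne_top _ _) h3]
  change μ.real _ = _
  rw [← h2, ← integral_toReal hκm.aemeasurable (ae_of_all _ fun ω => measure_lt_top _ _)]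
  rfl

/-- Given `(X, Y, T)` the prediction has law `κ (X)`, so it can be summed out label by label.
Nonnegative integrands avoid any integrability condition. -/
theorem lintegral_prediction {Yhat : Ω₀ → 𝓨} (hX : Measurable X)
    (hY : Measurable Y) (hT : Measurable T) (hYhat : Measurable Yhat) {κ : Kernel 𝓧 𝓨}
    [IsMarkovKernel κ] (hκ : HasCondDistrib Yhat X κ μ) (hM : MarkovProperty μ X Y T Yhat)
    {H : 𝓧 × 𝓨 × 𝓣 × 𝓨 → ENNReal} (hH : Measurable H) :
    ∫⁻ ω, H (X ω, Y ω, T ω, Yhat ω) ∂μ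
      = ∫⁻ ω, ∑' y, κ (X ω) {y} * H (X ω, Y ω, T ω, y) ∂μ := by
  have hV : Measurable fun ω => (X ω, Y ω, T ω) := by fun_prop
  have hκm : ∀ y, Measurable fun ω => κ (X ω) {y} := fun y =>
    (κ.measurable_coe (measurableSet_singleton y)).comp hX
  have hmeas : ∀ y, (μ.restrict (Yhat ⁻¹' {y})).map (fun ω => (X ω, Y ω, T ω))
      = (μ.withDensity fun ω => κ (X ω) {y}).map fun ω => (X ω, Y ω, T ω) := by
    intro y
    ext B hB
    rw [Measure.map_apply hV hB, Measure.map_apply hV hB, Measure.restrict_apply (hV hB),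
      withDensity_apply _ (hV hB), Set.inter_comm,
      measure_inter_preimage_of_markovProperty hX hY hT hYhat hκ hM y hB]
  have hHy : ∀ y, Measurable fun v : 𝓧 × 𝓨 × 𝓣 => H (v.1, v.2.1, v.2.2, y) := fun y => by fun_prop
  have hHy' : ∀ y, Measurable fun ω => H (X ω, Y ω, T ω, y) := fun y => by fun_prop
  have hprod : ∀ y, AEMeasurable (fun ω => κ (X ω) {y} * H (X ω, Y ω, T ω, y)) μ :=
    fun y => ((hκm y).mul (hHy' y)).aemeasurable
  rw [lintegral_tsum hprod]
  have hsplit : ∀ ω, H (X ω, Y ω, T ω, Yhat ω)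
      = ∑' y, (Yhat ⁻¹' {y}).indicator (fun ω => H (X ω, Y ω, T ω, y)) ω := by
    intro ω
    rw [tsum_eq_single (Yhat ω)]
    · simp
    · intro y hy
      simp [Set.indicator, Ne.symm hy]
  simp_rw [hsplit]
  rw [lintegral_tsum fun y =>
    ((hHy' y).indicator (hYhat (measurableSet_singleton y))).aemeasurable]
  refine tsum_congr fun y => ?_
  have h1 := congrArg (fun ν => ∫⁻ v, H (v.1, v.2.1, v.2.2, y) ∂ν) (hmeas y)
  simp only [lintegral_map (hHy y) hV] at h1
  rw [lintegral_indicator (hYhat (measurableSet_singleton y)), h1,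
    lintegral_withDensity_eq_lintegral_mul _ (hκm y) (hHy' y)]
  rfl

variable {n k : ℕ} (E : Input 𝓧 𝓨 𝓣 Θ n k) [IsMarkovKernel E.β] [IsMarkovKernel E.pol]
  {Yβ Yπ : Ω₀ → 𝓨} {Iβ Iπ : Ω₀ → ℝ}

/-- Reweighting turns the law of the data of the behavior model into that of the model `θ`. -/
theorem lintegral_importanceSampling (hX : Measurable X) (hY : Measurable Y) (hT : Measurable T)
    (hYβ : Measurable Yβ) (hIβ : Measurable Iβ) (hYπ : Measurable Yπ) (hIπ : Measurable Iπ) (θ : Θ)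
    (hβ : HasCondDistrib Yβ X E.β μ)
    (hπ : HasCondDistrib Yπ X (E.pol.comap (fun x => (θ, x)) measurable_prodMk_left) μ)
    (hMβ : MarkovProperty μ X Y T Yβ) (hMπ : MarkovProperty μ X Y T Yπ)
    (hI : ImpactInvariance μ X Y T Yβ Iβ Yπ Iπ) (hS : Support E)
    {F : DataPoint 𝓧 𝓨 𝓣 → ENNReal} (hF : Measurable F) :
    ∫⁻ ω, F (X ω, Y ω, T ω, Yπ ω, Iπ ω) ∂μ
      = ∫⁻ ω, ENNReal.ofReal (weight E θ (X ω) (Yβ ω)) * F (X ω, Y ω, T ω, Yβ ω, Iβ ω) ∂μ := by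
  obtain ⟨κ, hκ, hκβ, hκπ⟩ := hI
  -- Impact invariance: the same kernel `κ` integrates out the impact on both sides, leaving an
  -- identity about predictions alone.
  have himpact : ∀ {Yhat : Ω₀ → 𝓨} {I : Ω₀ → ℝ}, Measurable Yhat → Measurable I →
      HasCondDistrib I (fun ω => (X ω, Y ω, T ω, Yhat ω)) κ μ →
      ∀ G : (𝓧 × 𝓨 × 𝓣 × 𝓨) × ℝ → ENNReal, Measurable G →
      ∫⁻ ω, G ((X ω, Y ω, T ω, Yhat ω), I ω) ∂μ
        = ∫⁻ ω, ∫⁻ i, G ((X ω, Y ω, T ω, Yhat ω), i) ∂κ (X ω, Y ω, T ω, Yhat ω) ∂μ := by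
    intro Yhat I hYhat hI h G hG
    rw [← lintegral_map (f := G) (g := fun ω => ((X ω, Y ω, T ω, Yhat ω), I ω)) hG (by fun_prop),
      h.map_eq, Measure.lintegral_compProd hG,
      lintegral_map (Measurable.lintegral_kernel_prod_right' hG) (by fun_prop)]
  have hw : Measurable fun p : 𝓧 × 𝓨 × 𝓣 × 𝓨 => ENNReal.ofReal (weight E θ p.1 p.2.2.2) :=
    ENNReal.measurable_ofReal.comp <| (measurable_weight E).comp
      (g := fun q : (Θ × 𝓧) × 𝓨 => weight E q.1.1 q.1.2 q.2)
      (f := fun p : 𝓧 × 𝓨 × 𝓣 × 𝓨 => ((θ, p.1), p.2.2.2)) (by fun_prop)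
  let F' : (𝓧 × 𝓨 × 𝓣 × 𝓨) × ℝ → ENNReal :=
    fun p => F (p.1.1, p.1.2.1, p.1.2.2.1, p.1.2.2.2, p.2)
  have hF' : Measurable F' := by fun_prop
  have h1 := himpact hYπ hIπ hκπ F' hF'
  have h2 := himpact hYβ hIβ hκβ
    (fun p => ENNReal.ofReal (weight E θ p.1.1 p.1.2.2.2) * F' p) ((hw.comp measurable_fst).mul hF')
  refine h1.trans (Eq.trans ?_ h2.symm)
  have hK : Measurable fun p : 𝓧 × 𝓨 × 𝓣 × 𝓨 => ∫⁻ i, F' (p, i) ∂κ p :=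
    Measurable.lintegral_kernel_prod_right' hF'
  have h3 : ∀ p : 𝓧 × 𝓨 × 𝓣 × 𝓨,
      ∫⁻ i, ENNReal.ofReal (weight E θ p.1 p.2.2.2) * F' (p, i) ∂κ p
        = ENNReal.ofReal (weight E θ p.1 p.2.2.2) * ∫⁻ i, F' (p, i) ∂κ p := fun p =>
    lintegral_const_mul _ (hF'.comp measurable_prodMk_left)
  simp only [h3]
  have h4 := lintegral_prediction hX hY hT hYπ hπ hMπ hK
  have h5 := lintegral_prediction hX hY hT hYβ hβ hMβ (hw.mul hK)
  refine h4.trans (Eq.trans ?_ h5.symm)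
  refine lintegral_congr fun ω => tsum_congr fun y => ?_
  simp only [Pi.mul_apply]
  rw [← mul_assoc]
  congr 1
  rw [Kernel.comap_apply]
  have hp : E.pol (θ, X ω) {y} = ENNReal.ofReal (E.polProb θ (X ω) y) := by
    rw [Input.polProb, ofReal_measureReal]
  have hb : E.β (X ω) {y} = ENNReal.ofReal (E.behavProb (X ω) y) := by
    rw [Input.behavProb, ofReal_measureReal]
  have hb0 : 0 ≤ E.behavProb (X ω) y := measureReal_nonneg
  have hp0 : 0 ≤ E.polProb θ (X ω) y := measureReal_nonneg
  rw [hp, hb, ← ENNReal.ofReal_mul hb0, weight]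
  congr 1
  -- The identity is `π = β · (π / β)`. If `π = 0` both sides vanish, even when `β = 0`; otherwise
  -- the support assumption allows cancellation.
  rcases hp0.eq_or_lt with h0 | h0
  · rw [← h0]; simp
  · have := hS θ (X ω) y h0
    field_simp

/-- Stating the reweighting as a density between laws carries it over to the signed, possibly
nonintegrable impact. -/
theorem map_importanceSampling (hX : Measurable X) (hY : Measurable Y) (hT : Measurable T)
    (hYβ : Measurable Yβ) (hIβ : Measurable Iβ) (hYπ : Measurable Yπ) (hIπ : Measurable Iπ) (θ : Θ)
    (hβ : HasCondDistrib Yβ X E.β μ)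
    (hπ : HasCondDistrib Yπ X (E.pol.comap (fun x => (θ, x)) measurable_prodMk_left) μ)
    (hMβ : MarkovProperty μ X Y T Yβ) (hMπ : MarkovProperty μ X Y T Yπ)
    (hI : ImpactInvariance μ X Y T Yβ Iβ Yπ Iπ) (hS : Support E) :
    μ.map (fun ω => (X ω, Y ω, T ω, Yπ ω, Iπ ω))
      = (μ.map fun ω => (X ω, Y ω, T ω, Yβ ω, Iβ ω)).withDensity
        fun p => ENNReal.ofReal (weight E θ p.1 p.2.2.2.1) := by
  have hw : Measurable fun p : DataPoint 𝓧 𝓨 𝓣 => ENNReal.ofReal (weight E θ p.1 p.2.2.2.1) :=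
    ENNReal.measurable_ofReal.comp ((measurable_weight_dataPoint E).comp measurable_prodMk_left)
  refine Measure.ext_of_lintegral _ fun F hF => ?_
  rw [lintegral_map hF (by fun_prop), lintegral_withDensity_eq_lintegral_mul _ hw hF,
    lintegral_map (hw.mul hF) (by fun_prop)]
  exact lintegral_importanceSampling E hX hY hT hYβ hIβ hYπ hIπ θ hβ hπ hMβ hMπ hI hS hF

/-- The importance sampling identity for the mean of the impact given a condition on the features,
the label and the sensitive attribute; both sides are `0` if the impact is not integrable. -/
theorem integral_cond_importanceSampling (hX : Measurable X) (hY : Measurable Y) (hT : Measurable T)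
    (hYβ : Measurable Yβ) (hIβ : Measurable Iβ) (hYπ : Measurable Yπ) (hIπ : Measurable Iπ) (θ : Θ)
    (hβ : HasCondDistrib Yβ X E.β μ)
    (hπ : HasCondDistrib Yπ X (E.pol.comap (fun x => (θ, x)) measurable_prodMk_left) μ)
    (hMβ : MarkovProperty μ X Y T Yβ) (hMπ : MarkovProperty μ X Y T Yπ)
    (hI : ImpactInvariance μ X Y T Yβ Iβ Yπ Iπ) (hS : Support E)
    {c : 𝓧 × 𝓨 × 𝓣 → Bool} (hc : Measurable c) :
    ∫ ω, Iπ ω ∂(cond μ {ω | c (X ω, Y ω, T ω) = true})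
      = ∫ p, weight E θ p.1 p.2.2.2.1 * p.2.2.2.2
        ∂(ProbabilityTheory.cond (μ.map fun ω => (X ω, Y ω, T ω, Yβ ω, Iβ ω)) (flagSet c)) := by
  have hset := measurableSet_flagSet hc
  have hw : Measurable fun p : DataPoint 𝓧 𝓨 𝓣 => ENNReal.ofReal (weight E θ p.1 p.2.2.2.1) :=
    ENNReal.measurable_ofReal.comp ((measurable_weight_dataPoint E).comp measurable_prodMk_left)
  have hmap := map_importanceSampling E hX hY hT hYβ hIβ hYπ hIπ θ hβ hπ hMβ hMπ hI hS
  have h1 : ∫ ω in {ω | c (X ω, Y ω, T ω) = true}, Iπ ω ∂μ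
      = ∫ p in flagSet c, p.2.2.2.2 ∂(μ.map fun ω => (X ω, Y ω, T ω, Yπ ω, Iπ ω)) := by
    rw [setIntegral_map hset (Measurable.aestronglyMeasurable (by fun_prop)) (by fun_prop)]
    rfl
  -- The condition involves only `(x, y, t)`, common to both models, so the two conditional measures
  -- have the same normalizing constant.
  have h2 : (μ.map fun ω => (X ω, Y ω, T ω, Yβ ω, Iβ ω)) (flagSet c)
      = μ {ω | c (X ω, Y ω, T ω) = true} := by
    rw [Measure.map_apply (by fun_prop) hset]
    rfl
  rw [ProbabilityTheory.cond, ProbabilityTheory.cond, integral_smul_measure, integral_smul_measure,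
    h1, h2, hmap, restrict_withDensity hset,
    integral_withDensity_eq_integral_toReal_smul hw (ae_of_all _ fun _ => ENNReal.ofReal_lt_top)]
  simp only [ENNReal.toReal_ofReal (weight_nonneg E θ _ _), smul_eq_mul]

end ImportanceSampling

/-! ### Validity of the upper bounds for a frozen candidate -/

section UpperAt

variable {𝓧 𝓨 𝓣 Θ : Type*} [MeasurableSpace 𝓧] [MeasurableSpace 𝓨] [MeasurableSpace 𝓣]
  [MeasurableSpace Θ] {n k : ℕ} (E : Input 𝓧 𝓨 𝓣 Θ n k) (j : Fin k)

/-- The chosen confidence bound for the `j`-th constraint, as a function of the sample. -/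
def boundFn (A : Finset (Fin n)) (z : Fin n → ℝ) : EReal :=
  match E.bound with
  | .hoeff => boundHoeff (E.a j) (E.b j) (E.δ j) A z
  | .ttest => boundTtest (E.δ j) A z

/-- The upper bound `U_j` computed with the model `θ` in place of the candidate. -/
def upperAt (θ : Θ) (d : Fin n → DataPoint 𝓧 𝓨 𝓣) : EReal :=
  boundFn E j (E.fairIdx j d) fun i => E.estimate j θ (d i)

theorem upper_eq_upperAt (d : Fin n → DataPoint 𝓧 𝓨 𝓣) :
    E.upper j d = upperAt E j (E.candidate d) d := by
  unfold Input.upper upperAt boundFn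
  rfl

theorem measurable_boundFn (A : Finset (Fin n)) : Measurable (boundFn E j A) := by
  have h1 := measurable_sampleMean A
  have h2 := measurable_sampleStd A
  unfold boundFn
  cases E.bound with
  | hoeff =>
    unfold boundHoeff
    by_cases h : A.card = 0
    · simp only [h, if_true]; exact measurable_const
    · simp only [h, if_false]; exact Measurable.coe_real_ereal (by fun_prop)
  | ttest =>
    unfold boundTtest
    by_cases h : A.card ≤ 1
    · simp only [h, if_true]; exact measurable_const
    · simp only [h, if_false]; exact Measurable.coe_real_ereal (by fun_prop)

theorem boundFn_congr {A : Finset (Fin n)} {z z' : Fin n → ℝ} (h : ∀ i ∈ A, z i = z' i) :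
    boundFn E j A z = boundFn E j A z' := by
  have hm : sampleMean A z = sampleMean A z' := by
    simp only [sampleMean, Finset.sum_congr rfl h]
  have hs : sampleStd A z = sampleStd A z' := by
    simp only [sampleStd, hm]
    rw [Finset.sum_congr rfl fun i hi => by rw [h i hi]]
  unfold boundFn boundHoeff boundTtest
  simp only [hm, hs]

theorem fairIdx_congr {d d' : Fin n → DataPoint 𝓧 𝓨 𝓣} (h : ∀ i ∈ E.fair, d i = d' i) :
    E.fairIdx j d = E.fairIdx j d' :=
  Finset.filter_congr fun i hi => by rw [h i hi]

/-- With the model frozen, the bound reads only the fairness data, so the candidate points may be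
overwritten by fixed ones. -/
theorem upperAt_congr (θ : Θ) {d d' : Fin n → DataPoint 𝓧 𝓨 𝓣} (h : ∀ i ∈ E.fair, d i = d' i) :
    upperAt E j θ d = upperAt E j θ d' := by
  unfold upperAt
  rw [fairIdx_congr E j h]
  refine boundFn_congr E j fun i hi => ?_
  rw [h i (Finset.mem_filter.1 hi).1]

theorem measurable_fairIdx (hc : Measurable (E.c j)) :
    Measurable[_, (⊤ : MeasurableSpace (Finset (Fin n)))] (E.fairIdx j) := by
  have h := measurable_trueIdx (Ω := Fin n → DataPoint 𝓧 𝓨 𝓣)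
    (C := fun i d => decide (i ∈ E.fair) && E.c j (d i).xyt) fun i =>
      (measurable_of_finite fun b : Bool => decide (i ∈ E.fair) && b).comp
        ((measurable_flag hc).comp (measurable_pi_apply i))
  convert h using 1
  funext d
  ext i
  simp [Input.fairIdx, trueIdx]

variable [Countable 𝓨] [MeasurableSingletonClass 𝓨]

theorem measurable_estimate :
    Measurable fun q : Θ × DataPoint 𝓧 𝓨 𝓣 => E.estimate j q.1 q.2 :=
  ((measurable_weight_dataPoint E).mul (g := fun q : Θ × DataPoint 𝓧 𝓨 𝓣 => q.2.2.2.2.2)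
    (by fun_prop)).const_sub (E.τ j)

theorem measurable_estimate_right (θ : Θ) : Measurable (E.estimate j θ) :=
  Measurable.comp (g := fun q : Θ × DataPoint 𝓧 𝓨 𝓣 => E.estimate j q.1 q.2)
    (f := fun p => (θ, p)) (measurable_estimate E j) measurable_prodMk_left

/-- Joint measurability is what Fubini needs. The index set has finitely many values, so it is
enough to treat each fixed value. -/
theorem measurable_upperAt (hc : Measurable (E.c j)) :
    Measurable fun q : Θ × (Fin n → DataPoint 𝓧 𝓨 𝓣) => upperAt E j q.1 q.2 := by
  let _ : MeasurableSpace (Finset (Fin n)) := ⊤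
  have : DiscreteMeasurableSpace (Finset (Fin n)) := ⟨fun _ => trivial⟩
  have hz : Measurable fun q : Θ × (Fin n → DataPoint 𝓧 𝓨 𝓣) =>
      fun i => E.estimate j q.1 (q.2 i) :=
    measurable_pi_lambda _ fun i => Measurable.comp
      (g := fun q : Θ × DataPoint 𝓧 𝓨 𝓣 => E.estimate j q.1 q.2)
      (f := fun q : Θ × (Fin n → DataPoint 𝓧 𝓨 𝓣) => (q.1, q.2 i)) (measurable_estimate E j)
      (measurable_fst.prodMk ((measurable_pi_apply i).comp measurable_snd))
  have hS : Measurable fun q : Θ × (Fin n → DataPoint 𝓧 𝓨 𝓣) => E.fairIdx j q.2 :=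
    (measurable_fairIdx E j hc).comp measurable_snd
  exact (measurable_from_prod_countable_right
    (f := fun p : Finset (Fin n) × (Fin n → ℝ) => boundFn E j p.1 p.2)
    (measurable_boundFn E j)).comp (hS.prodMk hz)

end UpperAt

theorem map_cond_preimage {Ω α : Type*} [MeasurableSpace Ω] [MeasurableSpace α] {P : Measure Ω}
    {f : Ω → α} (hf : Measurable f) {s : Set α} (hs : MeasurableSet s) :
    (ProbabilityTheory.cond P (f ⁻¹' s)).map f = ProbabilityTheory.cond (P.map f) s := by
  ext t ht
  rw [Measure.map_apply hf ht, cond_apply (hf hs), cond_apply hs, Measure.map_apply hf hs,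
    Measure.map_apply hf (hs.inter ht)]
  rfl

theorem trueIdx_eq_fairIdx {Ω 𝓧 𝓨 𝓣 Θ : Type*} [MeasurableSpace 𝓧] [MeasurableSpace 𝓨]
    [MeasurableSpace 𝓣] [MeasurableSpace Θ] {n k : ℕ} (E : Input 𝓧 𝓨 𝓣 Θ n k) (j : Fin k)
    (D : Ω → Fin n → DataPoint 𝓧 𝓨 𝓣) (ω : Ω) :
    trueIdx (fun i ω => decide (i ∈ E.fair) && E.c j (D ω i).xyt) ω = E.fairIdx j (D ω) := by
  ext i
  simp [Input.fairIdx, trueIdx]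

section Frozen

variable {Ω 𝓧 𝓨 𝓣 Θ : Type*} [MeasurableSpace Ω] [MeasurableSpace 𝓧] [MeasurableSpace 𝓨]
  [MeasurableSpace 𝓣] [MeasurableSpace Θ] [Countable 𝓨] [MeasurableSingletonClass 𝓨]
  {n k : ℕ} (E : Input 𝓧 𝓨 𝓣 Θ n k) (j : Fin k) {Λ : Measure (DataPoint 𝓧 𝓨 𝓣)}
  [IsProbabilityMeasure Λ] {P : Measure Ω} [IsProbabilityMeasure P]
  {D : Ω → Fin n → DataPoint 𝓧 𝓨 𝓣}

/-- The objective of the model `θ`, expressed through the law `Λ` of the data points. -/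
def weightedObjective (Λ : Measure (DataPoint 𝓧 𝓨 𝓣)) (θ : Θ) : ℝ :=
  E.τ j - ∫ p, weight E θ p.1 p.2.2.2.1 * p.2.2.2.2 ∂(ProbabilityTheory.cond Λ (flagSet (E.c j)))

/-- The law of the estimate of the objective of `θ` from a data point that satisfies `c_j`. -/
def estimateLaw (Λ : Measure (DataPoint 𝓧 𝓨 𝓣)) (θ : Θ) : Measure ℝ :=
  (ProbabilityTheory.cond Λ (flagSet (E.c j))).map (E.estimate j θ)

/-- Integrability is essential: without it the left side would be `0` by convention and the right
side `τ_j`. Either bound's assumption supplies it. -/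
theorem integral_estimateLaw (hΛ : Λ (flagSet (E.c j)) ≠ 0) (θ : Θ)
    (hint : Integrable (fun x : ℝ => x) (estimateLaw E j Λ θ)) :
    ∫ x, x ∂(estimateLaw E j Λ θ) = weightedObjective E j Λ θ := by
  have hest := measurable_estimate_right E j θ
  have := cond_isProbabilityMeasure hΛ
  unfold estimateLaw at hint ⊢
  rw [integrable_map_measure (by fun_prop) hest.aemeasurable] at hint
  rw [integral_map hest.aemeasurable (by fun_prop), weightedObjective]
  have hw : Integrable (fun p : DataPoint 𝓧 𝓨 𝓣 => weight E θ p.1 p.2.2.2.1 * p.2.2.2.2)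
      (ProbabilityTheory.cond Λ (flagSet (E.c j))) := by
    refine ((integrable_const (E.τ j)).sub hint).congr (ae_of_all _ fun p => ?_)
    simp [Input.estimate, weight]
  have h := integral_sub (integrable_const (E.τ j)) hw
  simp only [integral_const, probReal_univ, one_smul] at h
  rw [← h]
  rfl

/-- For a fixed model `θ` that is unfair, the upper bound is at most `0` with probability at
most `δ_j`. -/
theorem measure_upperAt_le_zero (hc : Measurable (E.c j)) (hδ : E.δ j ∈ Set.Ioo (0 : ℝ) 1)
    (hD : ∀ i, Measurable fun ω => D ω i) (hindep : iIndepFun (fun i ω => D ω i) P)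
    (hlaw : ∀ i, P.map (fun ω => D ω i) = Λ) (θ : Θ)
    (hhoeff : E.bound = Bound.hoeff → ∀ᵐ ω ∂P, ∀ i ∈ E.fairIdx j (D ω),
      E.estimate j θ (D ω i) ∈ Set.Icc (E.a j) (E.b j))
    (httest : E.bound = Bound.ttest → ∀ m : ℕ, 1 ≤ m →
      P {ω | (E.fairIdx j (D ω)).card = m} ≠ 0 →
      IsGaussian ((ProbabilityTheory.cond P {ω | (E.fairIdx j (D ω)).card = m}).map
        fun ω => E.avgEstimate j θ (D ω)))
    (hθ : 0 < weightedObjective E j Λ θ) :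
    P {ω | upperAt E j θ (D ω) ≤ 0} ≤ ENNReal.ofReal (E.δ j) := by
  let _ : MeasurableSpace (Finset (Fin n)) := ⊤
  have : DiscreteMeasurableSpace (Finset (Fin n)) := ⟨fun _ => trivial⟩
  have hest := measurable_estimate_right E j θ
  have hfset := measurableSet_flagSet (𝓧 := 𝓧) (𝓨 := 𝓨) (𝓣 := 𝓣) hc
  set Z : Fin n → Ω → ℝ := fun i ω => E.estimate j θ (D ω i) with hZdef
  -- The flag includes membership in `D_f`, so the flagged indices are exactly those of `ĝ_j`.
  set C : Fin n → Ω → Bool := fun i ω => decide (i ∈ E.fair) && E.c j (D ω i).xyt with hCdef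
  have hZ : ∀ i, Measurable (Z i) := fun i => hest.comp (hD i)
  have hbool : ∀ i, Measurable fun p : DataPoint 𝓧 𝓨 𝓣 =>
      decide (i ∈ E.fair) && E.c j (DataPoint.xyt p) := fun i =>
    (measurable_of_finite fun b : Bool => decide (i ∈ E.fair) && b).comp (measurable_flag hc)
  have hC : ∀ i, Measurable (C i) := fun i => (hbool i).comp (hD i)
  have hind : iIndepFun (fun i ω => (Z i ω, C i ω)) P :=
    hindep.comp (fun i p => (E.estimate j θ p, decide (i ∈ E.fair) && E.c j (DataPoint.xyt p)))
      fun i => hest.prodMk (hbool i)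
  have hidx : ∀ ω, trueIdx C ω = E.fairIdx j (D ω) := fun ω => trueIdx_eq_fairIdx E j D ω
  have hCset : ∀ i, P (C i ⁻¹' {true}) ≠ 0 →
      C i ⁻¹' {true} = (fun ω => D ω i) ⁻¹' flagSet (E.c j) := by
    intro i hi
    have hif : i ∈ E.fair := by
      by_contra hif
      refine hi (measure_mono_null (t := ∅) (fun ω hω => ?_) measure_empty)
      simp [hCdef, hif] at hω
    ext ω
    simp [hCdef, hif, flagSet]
  have hρ : ∀ i, P (C i ⁻¹' {true}) ≠ 0 →
      (ProbabilityTheory.cond P (C i ⁻¹' {true})).map (Z i) = estimateLaw E j Λ θ := by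
    intro i hi
    rw [hCset i hi, estimateLaw, ← hlaw i, ← map_cond_preimage (hD i) hfset,
      Measure.map_map hest (hD i)]
    rfl
  refine measure_le_of_cond_fiber_le (measurable_trueIdx hC) fun A hA => ?_
  change P {ω | trueIdx C ω = A} ≠ 0 at hA
  change ProbabilityTheory.cond P {ω | trueIdx C ω = A} {ω | upperAt E j θ (D ω) ≤ 0} ≤ _
  set Q := ProbabilityTheory.cond P {ω | trueIdx C ω = A} with hQ
  have hQp : IsProbabilityMeasure Q := cond_isProbabilityMeasure hA
  have hAm : MeasurableSet {ω | trueIdx C ω = A} :=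
    measurable_trueIdx hC (measurableSet_singleton A)
  have hae : ∀ᵐ ω ∂Q, upperAt E j θ (D ω) = boundFn E j A fun i => Z i ω := by
    filter_upwards [ae_cond_mem hAm] with ω hω
    change trueIdx C ω = A at hω
    rw [upperAt, ← hidx, hω]
  have hset : Q {ω | upperAt E j θ (D ω) ≤ 0} = Q {ω | boundFn E j A (fun i => Z i ω) ≤ 0} := by
    refine measure_congr ?_
    filter_upwards [hae] with ω hω
    change (upperAt E j θ (D ω) ≤ 0) = (boundFn E j A (fun i => Z i ω) ≤ 0)
    rw [hω]
  rw [hset]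
  rcases A.eq_empty_or_nonempty with rfl | hAne
  · have : ∀ ω, boundFn E j ∅ (fun i => Z i ω) = ⊤ := by
      intro ω; unfold boundFn boundHoeff boundTtest; cases E.bound <;> simp
    simp [this]
  obtain ⟨i₀, hi₀⟩ := hAne
  have hC₀ := measure_flag_ne_zero hA hi₀
  -- A nonempty index set of positive probability shows that `c_j` has positive probability, so
  -- conditioning on it is not degenerate.
  have hΛ : Λ (flagSet (E.c j)) ≠ 0 := by
    rw [hCset i₀ hC₀, ← Measure.map_apply (hD i₀) hfset, hlaw i₀] at hC₀
    exact hC₀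
  have hindQ : iIndepFun Z Q := iIndepFun_cond_trueIdx hC hind hA
  have hlawQ : ∀ i ∈ A, Q.map (Z i) = estimateLaw E j Λ θ := fun i hi =>
    map_cond_trueIdx hZ hC hind hρ hA hi
  have hρp : IsProbabilityMeasure (estimateLaw E j Λ θ) := by
    rw [← hlawQ i₀ hi₀]
    exact Measure.isProbabilityMeasure_map (hZ i₀).aemeasurable
  cases hb : E.bound with
  | hoeff =>
    have hab : ∀ᵐ x ∂(estimateLaw E j Λ θ), x ∈ Set.Icc (E.a j) (E.b j) := by
      rw [← hlawQ i₀ hi₀]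
      refine (ae_map_iff (p := fun x => x ∈ Set.Icc (E.a j) (E.b j)) (hZ i₀).aemeasurable
        measurableSet_Icc).2 ?_
      filter_upwards [cond_absolutelyContinuous.ae_le (hhoeff hb), ae_cond_mem hAm] with ω hω hω'
      change trueIdx C ω = A at hω'
      refine hω i₀ ?_
      rw [← hidx, hω']
      exact hi₀
    have hint : Integrable (fun x : ℝ => x) (estimateLaw E j Λ θ) :=
      Integrable.of_mem_Icc (E.a j) (E.b j) aemeasurable_id' hab
    have h := measureReal_hoeffding_lt ⟨i₀, hi₀⟩ hZ hindQ hlawQ hab hδ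
    rw [integral_estimateLaw E j hΛ θ hint] at h
    refine le_trans (measure_mono fun ω hω => ?_) (ENNReal.le_ofReal_iff_toReal_le
      (measure_ne_top _ _) hδ.1.le |>.2 h)
    have hcard : A.card ≠ 0 := Finset.card_ne_zero_of_mem hi₀
    simp only [Set.mem_ofPred_eq, boundFn, hb, boundHoeff, hcard, if_false] at hω ⊢
    exact lt_of_le_of_lt (by exact_mod_cast hω) hθ
  | ttest =>
    by_cases hcard : A.card ≤ 1
    · have : ∀ ω, boundFn E j A (fun i => Z i ω) = ⊤ := by
        intro ω; simp [boundFn, boundTtest, hb, hcard]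
      simp [this]
    have hsub : {ω | trueIdx C ω = A} ⊆ {ω | (trueIdx C ω).card = A.card} := by
      intro ω hω
      change trueIdx C ω = A at hω
      change (trueIdx C ω).card = A.card
      rw [hω]
    have hPm : P {ω | (trueIdx C ω).card = A.card} ≠ 0 := fun h0 => hA (measure_mono_null hsub h0)
    -- Normality is assumed given the count, so it is invoked at `m = A.card` and passed down to
    -- single estimates before returning to the finer conditioning on `A`.
    have hG := httest hb A.card (by omega)
    simp only [← hidx, Input.avgEstimate] at hG
    obtain ⟨g, v, hgv⟩ := exists_eq_gaussianReal_of_isGaussian_mean hZ hC hind hρ (by omega) hPm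
      (hG hPm)
    have hint : Integrable (fun x : ℝ => x) (estimateLaw E j Λ θ) := by
      rw [hgv]; exact IsGaussian.integrable_id
    have hg : g = weightedObjective E j Λ θ := by
      rw [← integral_estimateLaw E j hΛ θ hint, hgv, integral_id_gaussianReal]
    have h := measureReal_ttest_lt (by omega) hZ hindQ (fun i hi => (hlawQ i hi).trans hgv) hδ
    rw [hg] at h
    refine le_trans (measure_mono fun ω hω => ?_) (ENNReal.le_ofReal_iff_toReal_le
      (measure_ne_top _ _) hδ.1.le |>.2 h)
    simp only [Set.mem_ofPred_eq, boundFn, hb, boundTtest, hcard, if_false] at hω ⊢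
    exact lt_of_le_of_lt (by exact_mod_cast hω) hθ

end Frozen

/-! ### Freezing the candidate -/

theorem measure_indepFun_eq_lintegral {Ω α β : Type*} [MeasurableSpace Ω] [MeasurableSpace α]
    [MeasurableSpace β] {P : Measure Ω} [IsProbabilityMeasure P] {U : Ω → α} {V : Ω → β}
    (hU : Measurable U) (hV : Measurable V) (hUV : IndepFun U V P) {B : Set (α × β)}
    (hB : MeasurableSet B) :
    P {ω | (U ω, V ω) ∈ B} = ∫⁻ ω, P {ω' | (U ω, V ω') ∈ B} ∂P := by
  have := Measure.isProbabilityMeasure_map (μ := P) hU.aemeasurable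
  have := Measure.isProbabilityMeasure_map (μ := P) hV.aemeasurable
  have h1 : P {ω | (U ω, V ω) ∈ B} = (P.map fun ω => (U ω, V ω)) B :=
    (Measure.map_apply (hU.prodMk hV) hB).symm
  rw [h1, (indepFun_iff_map_prod_eq_prod_map_map hU.aemeasurable hV.aemeasurable).1 hUV,
    Measure.prod_apply hB, lintegral_map (measurable_measure_prodMk_left hB) hU]
  refine lintegral_congr fun ω => ?_
  rw [Measure.map_apply hV (measurable_prodMk_left hB)]
  rfl

section Run

variable {Ω 𝓧 𝓨 𝓣 Θ : Type*} [MeasurableSpace Ω] [MeasurableSpace 𝓧] [MeasurableSpace 𝓨]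
  [MeasurableSpace 𝓣] [MeasurableSpace Θ]
  {n k : ℕ} (E : Input 𝓧 𝓨 𝓣 Θ n k) {P : Measure Ω}
  {D : Ω → Fin n → DataPoint 𝓧 𝓨 𝓣}

/-- The dataset whose points outside of the fairness part are replaced by those of `d₀`. -/
def fairData (d₀ d : Fin n → DataPoint 𝓧 𝓨 𝓣) : Fin n → DataPoint 𝓧 𝓨 𝓣 :=
  fun i => if i ∈ E.fair then d i else d₀ i

theorem fairData_of_mem (d₀ d : Fin n → DataPoint 𝓧 𝓨 𝓣) : ∀ i ∈ E.fair, fairData E d₀ d i = d i :=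
  fun _ hi => if_pos hi

theorem measurable_candidate (hselect : Measurable E.select)
    (hD : ∀ i, Measurable fun ω => D ω i) : Measurable fun ω => E.candidate (D ω) :=
  hselect.comp (measurable_pi_lambda _ fun i => hD i.1)

theorem measurable_fairData (d₀ : Fin n → DataPoint 𝓧 𝓨 𝓣)
    (hD : ∀ i, Measurable fun ω => D ω i) : Measurable fun ω => fairData E d₀ (D ω) := by
  refine measurable_pi_lambda _ fun i => ?_
  by_cases hi : i ∈ E.fair
  · simpa [fairData, hi] using hD i
  · simp [fairData, hi]

/-- The candidate is independent of the fairness data. -/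
theorem indepFun_candidate_fairData (hselect : Measurable E.select)
    (d₀ : Fin n → DataPoint 𝓧 𝓨 𝓣) (hD : ∀ i, Measurable fun ω => D ω i)
    (hindep : iIndepFun (fun i ω => D ω i) P) :
    IndepFun (fun ω => E.candidate (D ω)) (fun ω => fairData E d₀ (D ω)) P := by
  classical
  have h := hindep.indepFun_finset E.fairᶜ E.fair disjoint_compl_left hD
  have hφ : Measurable fun v : (E.fairᶜ : Finset (Fin n)) → DataPoint 𝓧 𝓨 𝓣 =>
      E.select fun i => v ⟨i.1, Finset.mem_compl.2 i.2⟩ :=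
    hselect.comp (measurable_pi_lambda _ fun i => measurable_pi_apply _)
  have hψ : Measurable fun v : E.fair → DataPoint 𝓧 𝓨 𝓣 =>
      fun i => if hi : i ∈ E.fair then v ⟨i, hi⟩ else d₀ i := by
    refine measurable_pi_lambda _ fun i => ?_
    by_cases hi : i ∈ E.fair
    · simpa [hi] using measurable_pi_apply _
    · simp [hi]
  have h' := h.comp hφ hψ
  have hV : (fun ω => fairData E d₀ (D ω)) = (fun v : E.fair → DataPoint 𝓧 𝓨 𝓣 =>
      fun i => if hi : i ∈ E.fair then v ⟨i, hi⟩ else d₀ i) ∘ fun ω (i : E.fair) => D ω i := by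
    funext ω i
    by_cases hi : i ∈ E.fair <;> simp [fairData, hi]
  rw [hV]
  exact h'

variable [IsProbabilityMeasure P] [Countable 𝓨] [MeasurableSingletonClass 𝓨]
  {Λ : Measure (DataPoint 𝓧 𝓨 𝓣)}
  [IsProbabilityMeasure Λ]

theorem measurable_weightedObjective (j : Fin k) : Measurable (weightedObjective E j Λ) := by
  have : SFinite (ProbabilityTheory.cond Λ (flagSet (E.c j))) := by
    unfold ProbabilityTheory.cond; infer_instance
  have h : Measurable fun q : Θ × DataPoint 𝓧 𝓨 𝓣 =>
      weight E q.1 q.2.1 q.2.2.2.2.1 * q.2.2.2.2.2 :=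
    (measurable_weight_dataPoint E).mul (g := fun q : Θ × DataPoint 𝓧 𝓨 𝓣 => q.2.2.2.2.2)
      (by fun_prop)
  exact (h.stronglyMeasurable.integral_prod_right'
    (ν := ProbabilityTheory.cond Λ (flagSet (E.c j)))).measurable.const_sub (E.τ j)

/-- The assumption couples the candidate and the fairness data at one outcome. Independence writes
the null probability of a violation as an integral of frozen violation probabilities, which
therefore vanish almost everywhere. -/
theorem ae_frozen_bounded (hc : ∀ j, Measurable (E.c j)) (hselect : Measurable E.select)
    (hD : ∀ i, Measurable fun ω => D ω i) (hindep : iIndepFun (fun i ω => D ω i) P) (j : Fin k)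
    (h : ∀ᵐ ω ∂P, ∀ i ∈ E.fairIdx j (D ω),
      E.estimate j (E.candidate (D ω)) (D ω i) ∈ Set.Icc (E.a j) (E.b j)) :
    ∀ᵐ ω ∂P, ∀ᵐ ω' ∂P, ∀ i ∈ E.fairIdx j (D ω'),
      E.estimate j (E.candidate (D ω)) (D ω' i) ∈ Set.Icc (E.a j) (E.b j) := by
  obtain ⟨ω₀⟩ := nonempty_of_isProbabilityMeasure P
  let B : Set (Θ × (Fin n → DataPoint 𝓧 𝓨 𝓣)) := {q | ¬ ∀ i, i ∈ E.fair → E.c j (q.2 i).xyt = true →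
      E.estimate j q.1 (q.2 i) ∈ Set.Icc (E.a j) (E.b j)}
  have hB : MeasurableSet B := by
    have hi : ∀ i, MeasurableSet {q : Θ × (Fin n → DataPoint 𝓧 𝓨 𝓣) | i ∈ E.fair →
        E.c j (q.2 i).xyt = true → E.estimate j q.1 (q.2 i) ∈ Set.Icc (E.a j) (E.b j)} := by
      intro i
      have h1 : Measurable fun q : Θ × (Fin n → DataPoint 𝓧 𝓨 𝓣) => q.2 i :=
        (measurable_pi_apply i).comp measurable_snd
      have h2 : MeasurableSet {q : Θ × (Fin n → DataPoint 𝓧 𝓨 𝓣) | E.c j (q.2 i).xyt = true} :=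
        ((measurable_flag (hc j)).comp h1) (measurableSet_singleton true)
      have h3 : MeasurableSet {q : Θ × (Fin n → DataPoint 𝓧 𝓨 𝓣) |
          E.estimate j q.1 (q.2 i) ∈ Set.Icc (E.a j) (E.b j)} :=
        (Measurable.comp (g := fun q : Θ × DataPoint 𝓧 𝓨 𝓣 => E.estimate j q.1 q.2)
          (f := fun q : Θ × (Fin n → DataPoint 𝓧 𝓨 𝓣) => (q.1, q.2 i)) (measurable_estimate E j)
          (measurable_fst.prodMk h1)) measurableSet_Icc
      exact (MeasurableSet.const _).imp (h2.imp h3)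
    convert (MeasurableSet.iInter hi).compl using 1
    ext q
    simp [B]
  have hiff : ∀ ω ω', (E.candidate (D ω), fairData E (D ω₀) (D ω')) ∈ B ↔
      ¬ ∀ i ∈ E.fairIdx j (D ω'),
        E.estimate j (E.candidate (D ω)) (D ω' i) ∈ Set.Icc (E.a j) (E.b j) := by
    intro ω ω'
    refine not_congr (forall_congr' fun i => ?_)
    rw [Input.fairIdx, Finset.mem_filter, and_imp]
    refine imp_congr_right fun hi => ?_
    simp only [fairData_of_mem E _ _ i hi]
  have hmU := measurable_candidate E hselect hD
  have hmV := measurable_fairData E (D ω₀) hD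
  have key := measure_indepFun_eq_lintegral hmU hmV
    (indepFun_candidate_fairData E hselect (D ω₀) hD hindep) hB
  simp only [hiff] at key
  rw [ae_iff] at h
  rw [h] at key
  have hmeas : Measurable fun ω => P {ω' | ¬ ∀ i ∈ E.fairIdx j (D ω'),
      E.estimate j (E.candidate (D ω)) (D ω' i) ∈ Set.Icc (E.a j) (E.b j)} := by
    have := (measurable_measure_prodMk_left
      (ν := P.map fun ω => fairData E (D ω₀) (D ω)) hB).comp hmU
    convert this using 1
    funext ω
    simp only [Function.comp]
    rw [Measure.map_apply hmV (measurable_prodMk_left hB)]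
    congr 1
    ext ω'
    exact (hiff ω ω').symm
  exact (lintegral_eq_zero_iff hmeas).1 key.symm

/-- An unfair candidate passes the test of the `j`-th constraint with probability at most `δ_j`. -/
theorem measure_upper_le_zero_and_unfair (hc : ∀ j, Measurable (E.c j))
    (hselect : Measurable E.select) (hδ : ∀ j, E.δ j ∈ Set.Ioo (0 : ℝ) 1)
    (hD : ∀ i, Measurable fun ω => D ω i) (hindep : iIndepFun (fun i ω => D ω i) P)
    (hlaw : ∀ i, P.map (fun ω => D ω i) = Λ) (hBound : EstimatesMatchBound E P D) (j : Fin k) :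
    MeasurableSet {ω | E.upper j (D ω) ≤ 0 ∧ 0 < weightedObjective E j Λ (E.candidate (D ω))} ∧
    P {ω | E.upper j (D ω) ≤ 0 ∧ 0 < weightedObjective E j Λ (E.candidate (D ω))}
      ≤ ENNReal.ofReal (E.δ j) := by
  -- Any dataset can fill the candidate slots; an actual outcome provides one without assuming the
  -- space of data points inhabited.
  obtain ⟨ω₀⟩ := nonempty_of_isProbabilityMeasure P
  let B : Set (Θ × (Fin n → DataPoint 𝓧 𝓨 𝓣)) :=
    {q | upperAt E j q.1 q.2 ≤ 0 ∧ 0 < weightedObjective E j Λ q.1}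
  have hB : MeasurableSet B :=
    (measurableSet_le (measurable_upperAt E j (hc j)) measurable_const).inter
      (measurableSet_lt measurable_const ((measurable_weightedObjective E j).comp measurable_fst))
  have hiff : ∀ ω ω', (E.candidate (D ω), fairData E (D ω₀) (D ω')) ∈ B ↔
      upperAt E j (E.candidate (D ω)) (D ω') ≤ 0 ∧
        0 < weightedObjective E j Λ (E.candidate (D ω)) := by
    intro ω ω'
    change _ ∧ _ ↔ _
    rw [upperAt_congr E j _ (fairData_of_mem E (D ω₀) (D ω'))]
  have hmU := measurable_candidate E hselect hD
  have hmV := measurable_fairData E (D ω₀) hD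
  have hset : {ω | E.upper j (D ω) ≤ 0 ∧ 0 < weightedObjective E j Λ (E.candidate (D ω))}
      = {ω | (E.candidate (D ω), fairData E (D ω₀) (D ω)) ∈ B} := by
    ext ω
    exact (upper_eq_upperAt E j (D ω) ▸ (hiff ω ω).symm :)
  refine ⟨hset ▸ (hmU.prodMk hmV) hB, ?_⟩
  rw [hset, measure_indepFun_eq_lintegral hmU hmV
    (indepFun_candidate_fairData E hselect (D ω₀) hD hindep) hB]
  -- A fair frozen candidate contributes the empty event; an unfair one falls under the bound for a
  -- fixed model.
  have hae : ∀ᵐ ω ∂P, P {ω' | (E.candidate (D ω), fairData E (D ω₀) (D ω')) ∈ B}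
      ≤ ENNReal.ofReal (E.δ j) := by
    have hh : ∀ᵐ ω ∂P, E.bound = Bound.hoeff → ∀ᵐ ω' ∂P, ∀ i ∈ E.fairIdx j (D ω'),
        E.estimate j (E.candidate (D ω)) (D ω' i) ∈ Set.Icc (E.a j) (E.b j) :=
      Filter.eventually_imp_distrib_left.2 fun hb =>
        ae_frozen_bounded E hc hselect hD hindep j (hBound.1 hb j)
    have ht := Filter.eventually_imp_distrib_left.2 fun hb : E.bound = Bound.ttest => hBound.2 hb j
    filter_upwards [hh, ht] with ω h1 h2
    simp only [hiff]
    by_cases hg : 0 < weightedObjective E j Λ (E.candidate (D ω))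
    · simp only [hg, and_true]
      exact measure_upperAt_le_zero E j (hc j) (hδ j) hD hindep hlaw _ h1 h2 hg
    · simp [hg]
  refine (lintegral_mono_ae hae).trans ?_
  simp

end Run

end ELF

end

/-! ### Conclusion for the output of the algorithm -/

theorem theorem2
    {𝓧 𝓨 𝓣 Θ Ω₀ Ω : Type*}
    [MeasurableSpace 𝓧] [MeasurableSpace 𝓨] [MeasurableSpace 𝓣] [MeasurableSpace Θ]
    [MeasurableSpace Ω₀] [MeasurableSpace Ω]
    [Countable 𝓨] [MeasurableSingletonClass 𝓨]
    {n k : ℕ}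
    -- the algorithm
    (E : ELF.Input 𝓧 𝓨 𝓣 Θ n k)
    [IsMarkovKernel E.β] [IsMarkovKernel E.pol]
    (hc : ∀ j, Measurable (E.c j)) (hselect : Measurable E.select)
    (hδ : ∀ j, E.δ j ∈ Set.Ioo (0 : ℝ) 1)
    -- the population: a generic data point, and its counterpart for every model
    (μ : Measure Ω₀) [IsProbabilityMeasure μ]
    (X : Ω₀ → 𝓧) (Y : Ω₀ → 𝓨) (T : Ω₀ → 𝓣)
    (Yβ : Ω₀ → 𝓨) (Iβ : Ω₀ → ℝ) (Yπ : Θ → Ω₀ → 𝓨) (Iπ : Θ → Ω₀ → ℝ)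
    (hX : Measurable X) (hY : Measurable Y) (hT : Measurable T)
    (hYβ : Measurable Yβ) (hIβ : Measurable Iβ)
    (hYπ : ∀ θ, Measurable (Yπ θ)) (hIπ : ∀ θ, Measurable (Iπ θ))
    -- predictions are drawn from the models
    (hβ : HasCondDistrib Yβ X E.β μ)
    (hπ : ∀ θ, HasCondDistrib (Yπ θ) X (E.pol.comap (fun x => (θ, x)) measurable_prodMk_left) μ)
    -- the assumptions
    (hMarkovβ : ELF.MarkovProperty μ X Y T Yβ)
    (hMarkovπ : ∀ θ, ELF.MarkovProperty μ X Y T (Yπ θ))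
    (hImpact : ∀ θ, ELF.ImpactInvariance μ X Y T Yβ Iβ (Yπ θ) (Iπ θ))
    (hSupport : ELF.Support E)
    -- the dataset: independent copies of the generic data point
    (P : Measure Ω) [IsProbabilityMeasure P]
    (D : Ω → Fin n → ELF.DataPoint 𝓧 𝓨 𝓣)
    (hD : ∀ i, Measurable fun ω => D ω i)
    (hindep : iIndepFun (fun (i : Fin n) (ω : Ω) => D ω i) P)
    (hident : ∀ i, IdentDistrib (fun ω => D ω i)
      (fun ω => (X ω, Y ω, T ω, Yβ ω, Iβ ω)) P μ)
    (hBound : ELF.EstimatesMatchBound E P D) :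
    ∀ j : Fin k,
      1 - E.δ j ≤
        P.real {ω | ELF.objective μ X Y T Iπ (E.c j) (E.τ j) (E.run (D ω)) ≤ 0} := by

  intro j
  set Λ := μ.map fun ω => (X ω, Y ω, T ω, Yβ ω, Iβ ω) with hΛ
  have hΛp : IsProbabilityMeasure Λ := Measure.isProbabilityMeasure_map (by fun_prop)
  have hlaw : ∀ i, P.map (fun ω => D ω i) = Λ := fun i => (hident i).map_eq
  obtain ⟨hm, hle⟩ := ELF.measure_upper_le_zero_and_unfair E hc hselect hδ hD hindep hlaw hBound j
  have hobj : ∀ θ, ELF.objective μ X Y T Iπ (E.c j) (E.τ j) (some θ)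
      = ELF.weightedObjective E j Λ θ := fun θ => by
    rw [ELF.objective, ELF.weightedObjective, ELF.integral_cond_importanceSampling E hX hY hT hYβ
      hIβ (hYπ θ) (hIπ θ) θ hβ (hπ θ) hMarkovβ (hMarkovπ θ) (hImpact θ) hSupport (hc j)]
  -- Only the failure event has to be measurable: its complement is contained in the event of the
  -- theorem, and monotonicity of the measure does the rest.
  have h1 : 1 - E.δ j ≤ P.real {ω | E.upper j (D ω) ≤ 0 ∧
      0 < ELF.weightedObjective E j Λ (E.candidate (D ω))}ᶜ := by
    rw [probReal_compl_eq_one_sub hm]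
    have := ENNReal.toReal_le_of_le_ofReal (hδ j).1.le hle
    rw [← measureReal_def] at this
    linarith
  refine h1.trans (measureReal_mono fun ω hω => ?_)
  change ELF.objective μ X Y T Iπ (E.c j) (E.τ j) (E.run (D ω)) ≤ 0
  unfold ELF.Input.run
  split_ifs with hrun
  · rw [hobj]
    by_contra hcon
    exact hω ⟨hrun j, not_le.1 hcon⟩
  · exact le_rfl
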